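/- **Setting.** In the best-choice prophet secretary problem, $x_1,\dots,x_n$ ($n\ge 1$) are drawn independently from known atomless distributions $D_1,\dots,D_n$ on $\mathbb R$ and revealed in a uniformly random order $x_{\pi_1},\dots,x_{\pi_n}$; at each step one either chooses the revealed value irrevocably and stops, or continues. An algorithm succeeds if it chooses a value equal to $\max_i x_i$. The distributions satisfy the *no $\varepsilon$-superstars assumption* if $\Pr[i=\arg\max_j x_j]\le\varepsilon$ for every $i$. Given real thresholds $\tau_1,\tau_2,\dots$, the *plain* threshold algorithm chooses the first value that is at least its threshold $\tau_k$ ($k$ being the step); the *record* threshold algorithm (the multi-threshold rule of Gilbert and Mosteller) chooses the first value that is at least its threshold $\tau_k$ and is not exceeded by any earlier value. In the i.i.d. setting, $m$ values are drawn independently from one atomless distribution $\mu$. **Theorem.** For $\gamma\in(0,1)$ put $$\varepsilon(\gamma)=\frac{\gamma^{10}}{24\log(2/\gamma^2)},\qquad m(\gamma)=\lceil 2/\gamma^2\rceil .$$ 1. Let $\gamma\in(0,1)$, let $\mu$ be an atomless distribution, and suppose that a (plain, respectively record) threshold algorithm selects the maximum of $m(\gamma)$ i.i.d. values from $\mu$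 with probability at least $\alpha$. Then for all $n\ge1$ and all atomless $D_1,\dots,D_n$ that satisfy the no $\varepsilon(\gamma)$-superstars assumption there is a (plain, respectively record) threshold algorithm, with thresholds $\tau_1,\dots,\tau_n\in\mathbb R$, that selects the maximum in the best-choice prophet secretary problem with probability at least $\alpha-13\gamma$. 2. The supremum over all thresholds of the success probability of record threshold algorithms on $m$ i.i.d. values from an atomless distribution $\mu$ converges, as $m\to\infty$, to a constant $\alpha_{GM}\ge 0.5801$ that does not depend on $\mu$ (the Gilbert–Mosteller bound), and for every $\gamma\in(0,1)$, every $n\ge1$ and all atomless $D_1,\dots,D_n$ that satisfy the no $\varepsilon(\gamma)$-superstars assumption there is a record threshold algorithm that selects the maximum in the best-choice prophet secretary problem with probability at least $\alpha_{GM}-13\gamma$. -/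

import Mathlib

open MeasureTheory Filter Topology

/-- The two usual readings of a threshold algorithm.  `plain`: choose a value if and only if it
reaches the threshold of its step.  `record`: choose a value if and only if it reaches the threshold
of its step and is a candidate, i.e. no earlier value exceeds it (the multi-threshold rule of
Gilbert and Mosteller). -/
inductive ThresholdRule : Type
  | plain
  | record

/-- With thresholds `τ`, the rule is willing to choose the value `x k` that is observed at step `k`.
This depends only on the values observed up to step `k`. -/
def ThresholdRule.Accepts {m : ℕ} (r : ThresholdRule) (τ x : Fin m → ℝ) (k : Fin m) : Prop :=
  match r with
  | .plain => τ k ≤ x k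
  | .record => τ k ≤ x k ∧ ∀ j < k, x j ≤ x k

/-- The process stops at step `k`: the value `x k` is accepted and no earlier value is. -/
def ThresholdRule.StopsAt {m : ℕ} (r : ThresholdRule) (τ x : Fin m → ℝ) (k : Fin m) : Prop :=
  r.Accepts τ x k ∧ ∀ j < k, ¬ r.Accepts τ x j

/-- On the observed sequence `x`, a value is chosen and it is the maximum of the sequence. -/
def ThresholdRule.SelectsMax {m : ℕ} (r : ThresholdRule) (τ x : Fin m → ℝ) : Prop :=
  ∃ k, r.StopsAt τ x k ∧ ∀ j, x j ≤ x k

/-- The probability that the threshold algorithm selects the maximum of `m` i.i.d. values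
with distribution `μ`. -/
noncomputable def iidSuccess (r : ThresholdRule) {m : ℕ} (μ : Measure ℝ) (σ : Fin m → ℝ) : ℝ :=
  (Measure.pi fun _ : Fin m => μ).real {x | r.SelectsMax σ x}

/-- The probability that the threshold algorithm selects the maximum in the best-choice prophet
secretary problem: the values `x i` are drawn independently from `D i` and presented in a uniformly
random order, so that step `k` reveals `x (π k)`. -/
noncomputable def secretarySuccess (r : ThresholdRule) {n : ℕ} (D : Fin n → Measure ℝ)
    (τ : Fin n → ℝ) : ℝ :=
  (∑ π : Equiv.Perm (Fin n), (Measure.pi D).real {x | r.SelectsMax τ (fun k => x (π k))}) /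
    (n.factorial : ℝ)

/-- The no `ε`-superstars assumption: no single value is the largest with probability more
than `ε`. -/
def NoSuperstars (ε : ℝ) {n : ℕ} (D : Fin n → Measure ℝ) : Prop :=
  ∀ i, (Measure.pi D).real {x | ∀ j, x j ≤ x i} ≤ ε

/-- The superstar bound `γ ^ 10 / (24 log (2 / γ ^ 2))`. -/
noncomputable def superstarBound (γ : ℝ) : ℝ :=
  γ ^ 10 / (24 * Real.log (2 / γ ^ 2))

/-- The number `1 / q = 2 / γ ^ 2` of i.i.d. values, rounded up when it is not an integer. -/
noncomputable def iidCount (γ : ℝ) : ℕ :=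
  ⌈2 / γ ^ 2⌉₊

/-- The optimal probability of selecting the maximum of `m` i.i.d. values with distribution `μ` by
a Gilbert-Mosteller multi-threshold rule. -/
noncomputable def iidOptimum (μ : Measure ℝ) (m : ℕ) : ℝ :=
  ⨆ σ : Fin m → ℝ, iidSuccess ThresholdRule.record μ σ

/-! The proof compares independent items in random order with `m` i.i.d. values by means of random
blocks. Give every item one of `m` labels, uniformly and independently, reveal the items block by
block, and let each step use the threshold of its block. The order within the list of steps is
uniformly random, so the labelled model is an average over block sizes, and some fixed sizes, that
is, some fixed thresholds for the steps, do at least as well (`exists_secretarySuccess_ge`).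

A block should act like one i.i.d. value `w` for which `w ^ m` is the distribution function of the
overall maximum. Thresholds are therefore quantiles of `maxLaw`. For the item `i` that attains the
maximum `v`, each other item `l` contributes a sum over blocks of its distribution function at the
bound of that block. By the inequality of arithmetic and geometric means this sum is at least `m`
times a geometric mean (`prod_sum_ge`). The product over `l` then depends only on the distribution
function of the maximum, and the substitution `u = w ^ m` returns the i.i.d. integral
(`mul_slotValue_le`). The blocks model also needs that no other item of the block of `i` is
acceptable. For fixed labels of the other items this spoils at most one label of `i`, a loss of `1 /
m` (`card_blockReaches_le`).

For the plain rule the i.i.d. success is a sum of such integrals for any thresholds. For the record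
rule this holds when the thresholds decrease in time: the position of the maximum of the first `K`
values is uniform, and none of them is chosen if that maximum misses the threshold of its own
position. Arbitrary record thresholds are first replaced by the optimal ones, which dynamic
programming shows to be antitone and independent of the distribution (`iidSuccess_record_le`,
`exists_antitone_optV_eq`).

The comparison, applied to i.i.d. items themselves, gives `optV k 0 - 1 / k ≤ optV m 0` for all
positive `k`, `m`, so the optimal values converge. The numerical bound uses thresholds with `t j ^
(m - j) = exp (-4 / 5)`, for which the value reduces to the exponential integral at `4 / 5`
(`optV_ge_expSum`, `expSum_ge`). -/

/-! ### Dynamic programming for i.i.d. uniform values -/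

/-- The optimal probability of selecting the maximum of a sequence of i.i.d. uniform values by a
record rule, when `r` values are still to come and the largest value so far is `v`. -/
noncomputable def optV : ℕ → ℝ → ℝ
  | 0, _ => 0
  | r + 1, v => v * optV r v + ∫ y in v..1, max (y ^ r) (optV r y)

lemma continuous_integral_lower {f : ℝ → ℝ} (hf : Continuous f) :
    Continuous fun v => ∫ y in v..1, f y := by
  have : (fun v => ∫ y in v..1, f y) = fun v => -∫ y in (1:ℝ)..v, f y := by
    funext v; rw [intervalIntegral.integral_symm]
  rw [this]
  exact (intervalIntegral.continuous_primitive (fun a b => hf.intervalIntegrable a b) 1).neg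

lemma continuous_optV (r : ℕ) : Continuous (optV r) := by
  induction r with
  | zero => exact continuous_const
  | succ r ih =>
    have h := continuous_integral_lower (f := fun y => max (y ^ r) (optV r y)) (by fun_prop)
    change Continuous fun v => v * optV r v + ∫ y in v..1, max (y ^ r) (optV r y)
    fun_prop

lemma continuous_max_optV (r : ℕ) : Continuous fun y : ℝ => max (y ^ r) (optV r y) :=
  (continuous_pow r).max (continuous_optV r)

lemma optV_nonneg (r : ℕ) : ∀ v ∈ Set.Icc (0:ℝ) 1, 0 ≤ optV r v := by
  induction r with
  | zero => intro v _; exact le_rfl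
  | succ r ih =>
    intro v hv
    have h1 : 0 ≤ ∫ y in v..1, max (y ^ r) (optV r y) :=
      intervalIntegral.integral_nonneg hv.2 fun y hy =>
        le_max_of_le_left (pow_nonneg (hv.1.trans hy.1) r)
    exact add_nonneg (mul_nonneg hv.1 (ih v hv)) h1

/-- Passing from `v` to `w` moves the interval `[v, w]` out of the integral. There the integrand is
at least `optV r w` by induction, which pays for the larger factor `w` in front. -/
lemma optV_antitoneOn (r : ℕ) : AntitoneOn (optV r) (Set.Icc 0 1) := by
  induction r with
  | zero => intro v _ w _ _; exact le_rfl
  | succ r ih =>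
    intro v hv w hw hvw
    have hc := continuous_max_optV r
    have hsplit := intervalIntegral.integral_add_adjacent_intervals
      (hc.intervalIntegrable (μ := volume) v w) (hc.intervalIntegrable (μ := volume) w 1)
    have hlow : (w - v) * optV r w ≤ ∫ y in v..w, max (y ^ r) (optV r y) := by
      have := intervalIntegral.integral_mono_on (μ := volume) hvw
        (intervalIntegrable_const (c := optV r w)) (hc.intervalIntegrable v w)
        fun y hy => le_max_of_le_right
          (ih ⟨hv.1.trans hy.1, hy.2.trans hw.2⟩ hw hy.2)
      simpa using this
    have hmono := mul_le_mul_of_nonneg_left (ih hv hw hvw) hv.1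
    simp only [optV]
    linarith

lemma optV_one (r : ℕ) : optV r 1 = 0 := by
  induction r with
  | zero => rfl
  | succ r ih => simp [optV, ih]

/-- The value of choosing the next observation whenever it exceeds `v`, and continuing optimally
otherwise. -/
lemma mul_optV_add_le (r : ℕ) {v : ℝ} (hv : v ∈ Set.Icc (0:ℝ) 1) :
    v * optV r v + (1 - v ^ (r + 1)) / (r + 1) ≤ optV (r + 1) v := by
  have := intervalIntegral.integral_mono_on (μ := volume) hv.2
    ((continuous_pow r).intervalIntegrable v 1) ((continuous_max_optV r).intervalIntegrable v 1)
    fun y _ => le_max_left (y ^ r) (optV r y)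
  rw [integral_pow] at this
  simp only [optV]
  simpa using this

/-- The value of waiting for the next value above `v` and choosing it: in the summand `i`, this
value is preceded by `r - 1 - i` values below `v` and followed by `i` values. -/
lemma sum_le_optV (r : ℕ) {v : ℝ} (hv : v ∈ Set.Icc (0:ℝ) 1) :
    ∑ i ∈ Finset.range r, (v ^ (r - 1 - i) - v ^ r) / (i + 1) ≤ optV r v := by
  induction r with
  | zero => simp [optV]
  | succ r ih =>
    refine le_trans ?_ (mul_optV_add_le r hv)
    rw [Finset.sum_range_succ]
    have h : ∑ i ∈ Finset.range r, (v ^ (r + 1 - 1 - i) - v ^ (r + 1)) / ((i:ℝ) + 1) =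
        v * ∑ i ∈ Finset.range r, (v ^ (r - 1 - i) - v ^ r) / ((i:ℝ) + 1) := by
      rw [Finset.mul_sum]
      refine Finset.sum_congr rfl fun i hi => ?_
      have hi := Finset.mem_range.1 hi
      rw [show r + 1 - 1 - i = (r - 1 - i) + 1 by omega, pow_succ, pow_succ]
      ring
    rw [h]
    have := mul_le_mul_of_nonneg_left ih hv.1
    simp
    linarith

/-- The indifference values of the optimal rule: with `r` values still to come, a candidate `y` is
worth choosing if and only if `θ r ≤ y`. -/
lemma exists_optV_threshold : ∃ θ : ℕ → ℝ, Monotone θ ∧ ∀ r, θ r ∈ Set.Icc (0:ℝ) 1 ∧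
    (∀ y ∈ Set.Icc (0:ℝ) 1, θ r ≤ y → optV r y ≤ y ^ r) ∧
    (∀ y ∈ Set.Icc (0:ℝ) 1, y < θ r → y ^ r ≤ optV r y) := by
  let S : ℕ → Set ℝ := fun r => Set.Icc 0 1 ∩ {v | optV r v ≤ v ^ r}
  have hne : ∀ r, (S r).Nonempty := fun r => ⟨1, by simp, by simp [optV_one]⟩
  have hbdd : ∀ r, BddBelow (S r) := fun r => ⟨0, fun v hv => hv.1.1⟩
  have hclosed : ∀ r, IsClosed (S r) := fun r =>
    isClosed_Icc.inter (isClosed_le (continuous_optV r) (continuous_pow r))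
  have hmem : ∀ r, sInf (S r) ∈ S r := fun r => (hclosed r).csInf_mem (hne r) (hbdd r)
  refine ⟨fun r => sInf (S r), monotone_nat_of_le_succ fun r => ?_, fun r => ⟨(hmem r).1, ?_, ?_⟩⟩
  -- Monotonicity is the inclusion `S (r + 1) ⊆ S r`: if stopping at `v` is optimal with `r + 1`
  -- values to come, `mul_optV_add_le` gives `v * optV r v ≤ v * v ^ r`.
  · refine csInf_le_csInf (hbdd r) (hne _) fun v hv => ⟨hv.1, ?_⟩
    have h1 : optV (r + 1) v ≤ v ^ (r + 1) := hv.2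
    have h2 := mul_optV_add_le r hv.1
    -- At `v = 0` the next value is a certain record, so the optimal value is at least `1 / (r +
    -- 1)`, while stopping is worth nothing.
    have hv0 : 0 < v := by
      rcases hv.1.1.eq_or_lt with h | h
      · subst h
        have : (0:ℝ) < ((r:ℝ) + 1)⁻¹ := by positivity
        simp at h1 h2
        linarith
      · exact h
    have h3 : 0 ≤ (1 - v ^ (r + 1)) / ((r:ℝ) + 1) :=
      div_nonneg (sub_nonneg.2 (pow_le_one₀ hv.1.1 hv.1.2)) (by positivity)
    have h4 : v * optV r v ≤ v * v ^ r := by rw [← pow_succ']; linarith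
    exact le_of_mul_le_mul_left h4 hv0
  · intro y hy hθ
    exact (optV_antitoneOn r (hmem r).1 hy hθ).trans
      ((hmem r).2.trans (pow_le_pow_left₀ (hmem r).1.1 hθ r))
  · intro y hy hlt
    by_contra! h
    exact absurd (csInf_le (hbdd r) ⟨hy, h.le⟩) (not_le.2 hlt)

/-! ### The optimal value as a formula in its thresholds -/

/-- Integration by parts against `y ↦ ∫ z in y..1, f z`. -/
lemma integral_pow_mul_integral {f : ℝ → ℝ} (hf : Continuous f) (k : ℕ) (a : ℝ) :
    (k + 1) * ∫ y in (0:ℝ)..a, y ^ k * ∫ z in y..1, f z =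
      a ^ (k + 1) * (∫ z in a..1, f z) + ∫ y in (0:ℝ)..a, y ^ (k + 1) * f y := by
  have hder : ∀ y ∈ Set.uIcc (0:ℝ) a, HasDerivAt (fun y => ∫ z in y..1, f z) (-f y) y := fun y _ =>
    intervalIntegral.integral_hasDerivAt_left (hf.intervalIntegrable _ _)
      (hf.stronglyMeasurableAtFilter _ _) hf.continuousAt
  have hpow : ∀ y ∈ Set.uIcc (0:ℝ) a,
      HasDerivAt (fun y : ℝ => y ^ (k + 1)) (((k + 1 : ℕ) : ℝ) * y ^ k) y := fun y _ => by
    simpa using hasDerivAt_pow (k + 1) y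
  have := intervalIntegral.integral_mul_deriv_eq_deriv_mul hpow hder
    (by apply Continuous.intervalIntegrable; fun_prop) (by apply Continuous.intervalIntegrable; fun_prop)
  simp only [mul_neg, intervalIntegral.integral_neg, mul_assoc,
    intervalIntegral.integral_const_mul] at this
  simp at this
  linarith

lemma integral_min_pow_mul {f : ℝ → ℝ} (hf : Continuous f) (k : ℕ) {a : ℝ}
    (ha : a ∈ Set.Icc (0:ℝ) 1) :
    ∫ y in (0:ℝ)..1, min a y ^ k * f y =
      (∫ y in (0:ℝ)..a, y ^ k * f y) + a ^ k * ∫ z in a..1, f z := by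
  have hc : Continuous fun y => min a y ^ k * f y := by fun_prop
  rw [← intervalIntegral.integral_add_adjacent_intervals
    (hc.intervalIntegrable 0 a) (hc.intervalIntegrable a 1), ← intervalIntegral.integral_const_mul]
  congr 1 <;> refine intervalIntegral.integral_congr fun y hy => ?_
  · rw [Set.uIcc_of_le ha.1] at hy
    simp [min_eq_right hy.2]
  · rw [Set.uIcc_of_le ha.2] at hy
    simp [min_eq_left hy.1]

/-- Given the thresholds `s 0 ≥ s 1 ≥ ⋯`, the conditional probability that none of the first `K`
values is chosen and all of them are at most `w`. -/
noncomputable def skipProb (s : ℕ → ℝ) (K : ℕ) (w : ℝ) : ℝ :=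
  if K = 0 then 1 else (∑ J ∈ Finset.range K, min (s J) w ^ K) / K

/-- The success probability, on i.i.d. uniform values, of the record rule with antitone thresholds
`s 0 ≥ s 1 ≥ ⋯`. -/
noncomputable def recordValue (m : ℕ) (s : ℕ → ℝ) : ℝ :=
  ∑ K ∈ Finset.range m, ∫ w in (s K)..1, w ^ (m - 1 - K) * skipProb s K w

lemma integral_eq_of_threshold {f g h : ℝ → ℝ} (hf : Continuous f) {a : ℝ}
    (ha : a ∈ Set.Icc (0:ℝ) 1) (h1 : ∀ y ∈ Set.Ioo 0 a, f y = g y)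
    (h2 : ∀ y ∈ Set.Ioo a 1, f y = h y) :
    ∫ y in (0:ℝ)..1, f y = (∫ y in (0:ℝ)..a, g y) + ∫ y in a..1, h y := by
  rw [← intervalIntegral.integral_add_adjacent_intervals
    (hf.intervalIntegrable 0 a) (hf.intervalIntegrable a 1)]
  congr 1 <;> refine intervalIntegral.integral_congr_uIoo fun y hy => ?_
  · rw [Set.uIoo_of_le ha.1] at hy
    exact h1 y hy
  · rw [Set.uIoo_of_le ha.2] at hy
    exact h2 y hy

/-- The recursion unrolled for `k + 1` observations. The second sum is the contribution of still
waiting: the maximum `y` so far came at step `J`, with density `y ^ k`, and missed the threshold of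
that step. Since the thresholds decrease in time, no other value seen so far was chosen either. -/
lemma optV_eq_partial {θ : ℕ → ℝ} (hmono : Monotone θ)
    (hθ : ∀ r, θ r ∈ Set.Icc (0:ℝ) 1 ∧ (∀ y ∈ Set.Icc (0:ℝ) 1, θ r ≤ y → optV r y ≤ y ^ r) ∧
      (∀ y ∈ Set.Icc (0:ℝ) 1, y < θ r → y ^ r ≤ optV r y)) (m : ℕ) (k : ℕ) (hk : k + 1 ≤ m) :
    optV m 0 = (∑ K ∈ Finset.range (k + 1), ∫ w in (θ (m - 1 - K))..1,
        w ^ (m - 1 - K) * skipProb (fun K => θ (m - 1 - K)) K w) +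
      ∑ J ∈ Finset.range (k + 1), ∫ y in (0:ℝ)..θ (m - 1 - J), y ^ k * optV (m - (k + 1)) y := by
  have hlow : ∀ r, ∀ y ∈ Set.Ioo 0 (θ r), max (y ^ r) (optV r y) = optV r y := fun r y hy =>
    max_eq_right ((hθ r).2.2 y ⟨hy.1.le, hy.2.le.trans (hθ r).1.2⟩ hy.2)
  have hhigh : ∀ r, ∀ y ∈ Set.Ioo (θ r) 1, max (y ^ r) (optV r y) = y ^ r := fun r y hy =>
    max_eq_left ((hθ r).2.1 y ⟨(hθ r).1.1.trans hy.1.le, hy.2.le⟩ hy.1.le)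
  induction k with
  | zero =>
    obtain ⟨m, rfl⟩ : ∃ m', m = m' + 1 := ⟨m - 1, by omega⟩
    simp only [optV, zero_mul, zero_add, Finset.sum_range_one, skipProb, if_true, mul_one,
      pow_zero, one_mul, Nat.add_sub_cancel, Nat.sub_zero]
    rw [add_comm]
    exact integral_eq_of_threshold (continuous_max_optV m) (hθ m).1 (hlow m) (hhigh m)
  | succ k ih =>
    rw [ih (by omega)]
    obtain ⟨r, hr⟩ : ∃ r, m = r + (k + 2) := ⟨m - (k + 2), by omega⟩
    have hr1 : m - (k + 1) = r + 1 := by omega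
    have hr2 : m - (k + 1 + 1) = r := by omega
    have hr3 : m - 1 - (k + 1) = r := by omega
    set s : ℕ → ℝ := fun K => θ (m - 1 - K) with hs
    have hsk : s (k + 1) = θ r := by simp only [hs, hr3]
    rw [hr1, hr2, Finset.sum_range_succ (fun K => ∫ w in (θ (m - 1 - K))..1, _) (k + 1), hr3,
      Finset.sum_range_succ (fun J => ∫ y in (0:ℝ)..θ (m - 1 - J), _) (k + 1), hr3]
    -- One step of the recursion under the integral. The summand `y * optV r y` keeps the maximum at
    -- step `J`; the inner integral becomes, by parts, the case of a new record `y` after `k + 1`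
    -- values with the old maximum below both `s J` and `y`.
    have hstep : ∀ J, ∫ y in (0:ℝ)..θ (m - 1 - J), y ^ k * optV (r + 1) y =
        (∫ y in (0:ℝ)..θ (m - 1 - J), y ^ (k + 1) * optV r y) +
        (∫ y in (0:ℝ)..1, min (s J) y ^ (k + 1) * max (y ^ r) (optV r y)) / (k + 1) := by
      intro J
      rw [integral_min_pow_mul (continuous_max_optV r) (k + 1) (hθ _).1, add_comm (∫ y in _.._, _)
        (_ * _), ← integral_pow_mul_integral (continuous_max_optV r) k, mul_div_cancel_left₀ _
        (by positivity), ← intervalIntegral.integral_add]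
      · refine intervalIntegral.integral_congr fun y _ => ?_
        simp only [optV]
        ring
      · have := continuous_optV r
        apply Continuous.intervalIntegrable
        fun_prop
      · have := continuous_integral_lower (continuous_max_optV r)
        apply Continuous.intervalIntegrable
        fun_prop
    simp_rw [hstep]
    rw [Finset.sum_add_distrib, ← Finset.sum_div, ← intervalIntegral.integral_finsetSum
      fun J _ => by
        have := continuous_max_optV r
        apply Continuous.intervalIntegrable
        fun_prop,
      ← intervalIntegral.integral_div]
    -- Below `θ r` all earlier thresholds exceed `y`, so the `k + 1` equal terms cancel the divisor
    -- and give the waiting term with the maximum at step `k + 1`. Above `θ r` the record is chosen.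
    have hfin : ∫ y in (0:ℝ)..1, (∑ J ∈ Finset.range (k + 1),
          min (s J) y ^ (k + 1) * max (y ^ r) (optV r y)) / ((k:ℝ) + 1) =
        (∫ y in (0:ℝ)..θ r, y ^ (k + 1) * optV r y) +
          ∫ w in θ r..1, w ^ r * skipProb s (k + 1) w := by
      refine integral_eq_of_threshold ?_ (hθ r).1 (fun y hy => ?_) fun y hy => ?_
      · have := continuous_max_optV r
        fun_prop
      · rw [hlow r y hy, ← Finset.sum_mul]
        have : ∀ J ∈ Finset.range (k + 1), min (s J) y ^ (k + 1) = y ^ (k + 1) := fun J hJ => by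
          rw [min_eq_right]
          exact hy.2.le.trans (hmono (by have := Finset.mem_range.1 hJ; omega))
        rw [Finset.sum_congr rfl this]
        simp
        field_simp
      · rw [hhigh r y hy, ← Finset.sum_mul]
        simp [skipProb]
        field_simp
    rw [hfin]
    ring

lemma optV_eq_recordValue {θ : ℕ → ℝ} (hmono : Monotone θ)
    (hθ : ∀ r, θ r ∈ Set.Icc (0:ℝ) 1 ∧ (∀ y ∈ Set.Icc (0:ℝ) 1, θ r ≤ y → optV r y ≤ y ^ r) ∧
      (∀ y ∈ Set.Icc (0:ℝ) 1, y < θ r → y ^ r ≤ optV r y)) (m : ℕ) :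
    optV m 0 = recordValue m fun K => θ (m - 1 - K) := by
  cases m with
  | zero => simp [optV, recordValue]
  | succ m =>
    rw [optV_eq_partial hmono hθ (m + 1) m le_rfl]
    simp [recordValue, optV]

lemma exists_antitone_optV_eq (m : ℕ) :
    ∃ s : ℕ → ℝ, Antitone s ∧ (∀ k, s k ∈ Set.Icc (0:ℝ) 1) ∧ optV m 0 = recordValue m s := by
  obtain ⟨θ, hmono, hθ⟩ := exists_optV_threshold
  exact ⟨fun K => θ (m - 1 - K), fun a b hab => hmono (by omega), fun k => (hθ _).1,
    optV_eq_recordValue hmono hθ m⟩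

/-! ### Lower bounds for the optimal value from explicit thresholds -/

/-- A lower bound for the optimal success probability in terms of thresholds `t`: the first summand
is the gain when a value above its threshold is chosen immediately, the second when the
largest value so far overtakes the threshold while waiting. -/
lemma optV_ge_partial {t : ℕ → ℝ} (ht : ∀ k, t k ∈ Set.Icc (0:ℝ) 1) (m : ℕ)
    {H : ℕ → ℝ} (hanti : ∀ k, k + 1 < m → t (k + 1) ≤ t k)
    (hH : ∀ k, k + 1 < m → ∀ y ∈ Set.Icc (t (k + 1)) (t k), H (m - (k + 1)) ≤ optV (m - (k + 1)) y)
    (k : ℕ) (hk : k + 1 ≤ m) :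
    (∑ j ∈ Finset.range (k + 1), t j ^ j * ((1 - t j ^ (m - j)) / (m - j : ℕ))) +
      (∑ j ∈ Finset.range k, (t j ^ (j + 1) - t (j + 1) ^ (j + 1)) * H (m - (j + 1))) +
      (k + 1) * ∫ y in (0:ℝ)..t k, y ^ k * optV (m - (k + 1)) y ≤ optV m 0 := by
  induction k with
  | zero =>
    obtain ⟨m, rfl⟩ : ∃ m', m = m' + 1 := ⟨m - 1, by omega⟩
    have hc := continuous_max_optV m
    have h1 := intervalIntegral.integral_mono_on (μ := volume) (ht 0).1
      ((continuous_optV m).intervalIntegrable _ _) (hc.intervalIntegrable _ _)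
      fun y _ => le_max_right (y ^ m) (optV m y)
    have h2 := intervalIntegral.integral_mono_on (μ := volume) (ht 0).2
      ((continuous_pow m).intervalIntegrable _ _) (hc.intervalIntegrable _ _)
      fun y _ => le_max_left (y ^ m) (optV m y)
    have h3 := intervalIntegral.integral_add_adjacent_intervals
      (hc.intervalIntegrable (μ := volume) 0 (t 0)) (hc.intervalIntegrable (μ := volume) (t 0) 1)
    rw [integral_pow] at h2
    simp [optV] at *
    linarith
  | succ k ih =>
    refine le_trans ?_ (ih (by omega))
    obtain ⟨r, hr⟩ : ∃ r, m = r + (k + 2) := ⟨m - (k + 2), by omega⟩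
    have hr1 : m - (k + 1) = r + 1 := by omega
    have hr2 : m - (k + 1 + 1) = r := by omega
    have hc := continuous_max_optV r
    have ho := continuous_optV r
    have ho1 := continuous_optV (r + 1)
    have hH := hH k (by omega)
    rw [Finset.sum_range_succ _ (k + 1),
      Finset.sum_range_succ (fun j => (t j ^ (j + 1) - t (j + 1) ^ (j + 1)) * _) k, hr1, hr2]
    rw [hr1] at hH
    set b := t (k + 1)
    have hb : b ∈ Set.Icc (0:ℝ) 1 := ht (k + 1)
    have hba : b ≤ t k := hanti k (by omega)
    have hsplit := intervalIntegral.integral_add_adjacent_intervals (μ := volume)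
      (f := fun y => y ^ k * optV (r + 1) y) (a := 0) (b := b) (c := t k)
      (by apply Continuous.intervalIntegrable; fun_prop)
      (by apply Continuous.intervalIntegrable; fun_prop)
    -- `(k + 1) * y ^ k` is the density of the maximum of `k + 1` values; here this maximum lies
    -- between the next threshold and the present one.
    have hupper : (t k ^ (k + 1) - b ^ (k + 1)) * H (r + 1) ≤
        (k + 1) * ∫ y in b..t k, y ^ k * optV (r + 1) y := by
      have := intervalIntegral.integral_mono_on (μ := volume) hba
        (f := fun y => y ^ k * H (r + 1)) (g := fun y => y ^ k * optV (r + 1) y)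
        (by apply Continuous.intervalIntegrable; fun_prop)
        (by apply Continuous.intervalIntegrable; fun_prop)
        fun y hy => mul_le_mul_of_nonneg_left (hH y hy) (pow_nonneg (hb.1.trans hy.1) k)
      rw [intervalIntegral.integral_mul_const, integral_pow] at this
      calc _ = (k + 1) * ((t k ^ (k + 1) - b ^ (k + 1)) / (k + 1) * H (r + 1)) := by field_simp
        _ ≤ _ := mul_le_mul_of_nonneg_left this (by positivity)
    have hlower : (k + 1) * ∫ y in (0:ℝ)..b, y ^ k * optV (r + 1) y =
        (k + 1) * (∫ y in (0:ℝ)..b, y ^ (k + 1) * optV r y) +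
          (b ^ (k + 1) * (∫ y in b..1, max (y ^ r) (optV r y)) +
            ∫ y in (0:ℝ)..b, y ^ (k + 1) * max (y ^ r) (optV r y)) := by
      rw [← integral_pow_mul_integral hc, ← mul_add, ← intervalIntegral.integral_add]
      · congr 1
        refine intervalIntegral.integral_congr fun y _ => ?_
        simp only [optV]
        ring
      · apply Continuous.intervalIntegrable
        fun_prop
      · have := continuous_integral_lower hc
        apply Continuous.intervalIntegrable
        fun_prop
    have h1 := intervalIntegral.integral_mono_on (μ := volume) hb.1
      (f := fun y => y ^ (k + 1) * optV r y) (g := fun y => y ^ (k + 1) * max (y ^ r) (optV r y))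
      (by apply Continuous.intervalIntegrable; fun_prop)
      (by apply Continuous.intervalIntegrable; fun_prop)
      fun y hy => mul_le_mul_of_nonneg_left (le_max_right _ _) (pow_nonneg hy.1 _)
    have h2 := intervalIntegral.integral_mono_on (μ := volume) hb.2
      ((continuous_pow r).intervalIntegrable _ _) (hc.intervalIntegrable _ _)
      fun y _ => le_max_left (y ^ r) (optV r y)
    rw [integral_pow] at h2
    have h3 := mul_le_mul_of_nonneg_left h2 (pow_nonneg hb.1 (k + 1))
    have hm : m - (k + 1) = r + 1 := by omega
    rw [← hsplit, mul_add, hlower]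
    push_cast
    simp only [one_pow] at h3
    linarith

lemma optV_ge {t : ℕ → ℝ} (ht : ∀ k, t k ∈ Set.Icc (0:ℝ) 1) (m : ℕ)
    {H : ℕ → ℝ} (hanti : ∀ k, k + 1 < m → t (k + 1) ≤ t k)
    (hH : ∀ k, k + 1 < m → ∀ y ∈ Set.Icc (t (k + 1)) (t k), H (m - (k + 1)) ≤ optV (m - (k + 1)) y) :
    (∑ j ∈ Finset.range m, t j ^ j * ((1 - t j ^ (m - j)) / (m - j : ℕ))) +
      (∑ j ∈ Finset.range (m - 1), (t j ^ (j + 1) - t (j + 1) ^ (j + 1)) * H (m - (j + 1))) ≤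
      optV m 0 := by
  cases m with
  | zero => simp [optV]
  | succ m =>
    have := optV_ge_partial ht (m + 1) hanti hH m le_rfl
    simpa [optV] using this

/-! ### Estimates for the exponential integral -/

/-- The Taylor polynomials of `exp (-t)` at `0` lie alternately above and below it. -/
lemma exp_neg_sub_taylor_alternating (n : ℕ) : ∀ t : ℝ, 0 ≤ t →
    0 ≤ (-1) ^ n * (Real.exp (-t) - ∑ k ∈ Finset.range n, (-t) ^ k / (k.factorial : ℝ)) := by
  induction n with
  | zero => intro t _; simpa using (Real.exp_pos _).le
  | succ n ih =>
    intro t ht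
    have hsum : ∀ x : ℝ, HasDerivAt
        (fun x : ℝ => ∑ k ∈ Finset.range (n + 1), (-x) ^ k / (k.factorial : ℝ))
        (-∑ k ∈ Finset.range n, (-x) ^ k / (k.factorial : ℝ)) x := by
      intro x
      have : ∀ k ∈ Finset.range (n + 1), HasDerivAt (fun x : ℝ => (-x) ^ k / (k.factorial : ℝ))
          ((k : ℝ) * (-x) ^ (k - 1) * (-1) / (k.factorial : ℝ)) x := fun k _ =>
        ((hasDerivAt_neg x).pow k).div_const _
      refine (HasDerivAt.fun_sum this).congr_deriv ?_
      rw [Finset.sum_range_succ', ← Finset.sum_neg_distrib]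
      simp only [Nat.cast_zero, zero_mul, zero_div, add_zero]
      refine Finset.sum_congr rfl fun k _ => ?_
      rw [Nat.factorial_succ]
      push_cast
      have : (k.factorial : ℝ) ≠ 0 := by positivity
      field_simp
    have hder : ∀ x : ℝ, HasDerivAt (fun x => (-1) ^ (n + 1) * (Real.exp (-x) -
        ∑ k ∈ Finset.range (n + 1), (-x) ^ k / (k.factorial : ℝ)))
        ((-1) ^ n * (Real.exp (-x) - ∑ k ∈ Finset.range n, (-x) ^ k / (k.factorial : ℝ))) x := by
      intro x
      refine ((((hasDerivAt_neg x).exp).sub (hsum x)).const_mul ((-1) ^ (n + 1))).congr_deriv ?_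
      ring
    have hmono : MonotoneOn (fun x => (-1) ^ (n + 1) * (Real.exp (-x) -
        ∑ k ∈ Finset.range (n + 1), (-x) ^ k / (k.factorial : ℝ))) (Set.Ici 0) := by
      refine monotoneOn_of_deriv_nonneg (convex_Ici 0)
        (fun x _ => (hder x).continuousAt.continuousWithinAt)
        (fun x _ => (hder x).differentiableAt.differentiableWithinAt) fun x hx => ?_
      rw [(hder x).deriv]
      rw [interior_Ici] at hx
      exact ih x (le_of_lt hx)
    have h0 := hmono (Set.mem_Ici.2 le_rfl) (Set.mem_Ici.2 ht) ht
    refine le_trans (le_of_eq ?_) h0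
    simp [Finset.sum_range_succ']

/-- The number of terms is even, so the polynomial lies below. -/
lemma sum_taylor_le_exp_neg {t : ℝ} (ht : 0 ≤ t) :
    ∑ k ∈ Finset.range 16, (-t) ^ k / (k.factorial : ℝ) ≤ Real.exp (-t) := by
  have := exp_neg_sub_taylor_alternating 16 t ht
  norm_num at this ⊢
  exact this

/-- The integrand of the exponential integral `E₁ (4 / 5) = ∫ u in 0..1, expKernel u`. -/
noncomputable def expKernel (u : ℝ) : ℝ := Real.exp (-(4 / 5 / u)) / u

/-- The derivative of the kernel is at least `-4`: with `q = 4 / (5 x)`, `exp q ≥ q ^ 2 / 2` gives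
`exp (-q) / x ^ 2 ≤ 25 / 8`. -/
lemma expKernel_le_add {u b : ℝ} (hu : 0 < u) (hub : u ≤ b) :
    expKernel u ≤ expKernel b + 4 * (b - u) := by
  have hder : ∀ x ∈ Set.Icc u b, HasDerivAt (fun x => expKernel x + 4 * x)
      (Real.exp (-(4 / 5 / x)) * (4 / 5 / x - 1) / x ^ 2 + 4) x := by
    intro x hx
    have hx0 : x ≠ 0 := (hu.trans_le hx.1).ne'
    have h1 : HasDerivAt (fun x : ℝ => -(4 / 5 / x)) (4 / 5 / x ^ 2) x := by
      refine (((hasDerivAt_inv hx0).const_mul (4 / 5 : ℝ)).neg).congr_deriv ?_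
      field_simp
    refine ((h1.exp.div (hasDerivAt_id x) hx0).add ((hasDerivAt_id x).const_mul 4)).congr_deriv ?_
    simp only [id]
    field_simp
  have hmono : MonotoneOn (fun x => expKernel x + 4 * x) (Set.Icc u b) := by
    refine monotoneOn_of_deriv_nonneg (convex_Icc _ _)
      (fun x hx => (hder x hx).continuousAt.continuousWithinAt)
      (fun x hx => (hder x (interior_subset hx)).differentiableAt.differentiableWithinAt)
      fun x hx => ?_
    have hx := interior_subset hx
    rw [(hder x hx).deriv]
    have hx0 : 0 < x := hu.trans_le hx.1
    have hq : 0 < 4 / 5 / x := by positivity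
    have h1 := Real.quadratic_le_exp_of_nonneg hq.le
    have h2 : Real.exp (-(4 / 5 / x)) * Real.exp (4 / 5 / x) = 1 := by
      rw [← Real.exp_add]; simp
    have hp := Real.exp_pos (-(4 / 5 / x))
    have h3 : Real.exp (-(4 / 5 / x)) * ((4 / 5 / x) ^ 2 / 2) ≤ 1 := by
      rw [← h2]
      exact mul_le_mul_of_nonneg_left (by nlinarith) hp.le
    have h4 : Real.exp (-(4 / 5 / x)) / x ^ 2 ≤ 4 := by
      have : Real.exp (-(4 / 5 / x)) * ((4 / 5 / x) ^ 2 / 2) =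
        8 / 25 * (Real.exp (-(4 / 5 / x)) / x ^ 2) := by field_simp; norm_num
      linarith
    have h5 : Real.exp (-(4 / 5 / x)) * (4 / 5 / x - 1) / x ^ 2 =
      Real.exp (-(4 / 5 / x)) / x ^ 2 * (4 / 5 / x) - Real.exp (-(4 / 5 / x)) / x ^ 2 := by
      field_simp
    rw [h5]
    have : 0 ≤ Real.exp (-(4 / 5 / x)) / x ^ 2 * (4 / 5 / x) := by positivity
    linarith
  have := hmono (Set.left_mem_Icc.2 hub) (Set.right_mem_Icc.2 hub) hub
  simp only at this
  linarith

lemma sub_le_mul_expKernel {Φ Φ' : ℝ → ℝ} {a b : ℝ} (ha : 0 < a) (hab : a ≤ b)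
    (hder : ∀ u ∈ Set.Icc a b, HasDerivAt Φ (Φ' u) u)
    (hle : ∀ u ∈ Set.Icc a b, Φ' u ≤ expKernel u) :
    Φ b - Φ a ≤ (b - a) * (expKernel b + 4 * (b - a)) := by
  rw [mul_comm]
  refine (convex_Icc a b).image_sub_le_mul_sub_of_deriv_le
    (fun x hx => (hder x hx).continuousAt.continuousWithinAt)
    (fun x hx => (hder x (interior_subset hx)).differentiableAt.differentiableWithinAt)
    (fun x hx => ?_) a (Set.left_mem_Icc.2 hab) b (Set.right_mem_Icc.2 hab) hab
  have hx := interior_subset hx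
  rw [(hder x hx).deriv]
  have := expKernel_le_add (ha.trans_le hx.1) hx.2
  linarith [hle x hx, hx.1]

/-- A right-endpoint Riemann sum on the grid `1 / m`; each cell costs at most `4 / m ^ 2` by
`expKernel_le_add`. -/
lemma sub_le_sum_expKernel {Φ Φ' : ℝ → ℝ} {m p q : ℕ} (hp : 0 < p) (hpq : p ≤ q) (hm : 0 < m)
    (hder : ∀ u ∈ Set.Icc (p / m : ℝ) (q / m), HasDerivAt Φ (Φ' u) u)
    (hle : ∀ u ∈ Set.Icc (p / m : ℝ) (q / m), Φ' u ≤ expKernel u) :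
    Φ (q / m) - Φ (p / m) ≤
      ∑ r ∈ Finset.Ico p q, (expKernel ((r + 1 : ℕ) / m) / m + 4 / m ^ 2) := by
  have hm' : (0:ℝ) < m := Nat.cast_pos.2 hm
  have htel := Finset.sum_Ico_sub (fun r : ℕ => Φ (r / m)) hpq
  rw [← htel]
  refine Finset.sum_le_sum fun r hr => ?_
  obtain ⟨h1, h2⟩ := Finset.mem_Ico.1 hr
  have hsub : Set.Icc (r / m : ℝ) ((r + 1 : ℕ) / m) ⊆ Set.Icc (p / m : ℝ) (q / m) := by
    refine Set.Icc_subset_Icc ?_ ?_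
    · gcongr
    · gcongr
      omega
  have hr0 : (0:ℝ) < r / m := div_pos (Nat.cast_pos.2 (hp.trans_le h1)) hm'
  have := sub_le_mul_expKernel (b := ((r + 1 : ℕ) / m : ℝ)) hr0 (by gcongr; omega)
    (fun u hu => hder u (hsub hu)) (fun u hu => hle u (hsub hu))
  refine this.trans (le_of_eq ?_)
  push_cast
  field_simp
  ring

/-- On `(0, 1 / 4]` the kernel is bounded below by the derivative of this function, a convergent of
the continued fraction of the exponential integral. -/
noncomputable def expPrimitiveLow (u : ℝ) : ℝ :=
  Real.exp (-(4 / 5 / u)) * ((4 / 5 / u + 3) / ((4 / 5 / u) ^ 2 + 4 * (4 / 5 / u) + 2))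

/-- In terms of `t = 4 / (5 u)`, the derivative is the kernel times `1 - 4 / (t ^ 2 + 4 * t + 2) ^
2`. -/
lemma hasDerivAt_expPrimitiveLow {u : ℝ} (hu : 0 < u) :
    ∃ d, HasDerivAt expPrimitiveLow d u ∧ d ≤ expKernel u := by
  set t := 4 / 5 / u with ht
  have ht0 : 0 < t := by positivity
  have h1 : HasDerivAt (fun x : ℝ => 4 / 5 / x) (-(t ^ 2 * (5 / 4))) u := by
    refine ((hasDerivAt_inv hu.ne').const_mul (4 / 5 : ℝ)).congr_deriv ?_
    rw [ht]; field_simp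
  have hden : t ^ 2 + 4 * t + 2 ≠ 0 := by positivity
  have h2 : HasDerivAt (fun t : ℝ => Real.exp (-t) * ((t + 3) / (t ^ 2 + 4 * t + 2)))
      (Real.exp (-t) * (-1) * ((t + 3) / (t ^ 2 + 4 * t + 2)) + Real.exp (-t) *
        ((1 * (t ^ 2 + 4 * t + 2) - (t + 3) * (2 * t + 4)) / (t ^ 2 + 4 * t + 2) ^ 2)) t := by
    refine (hasDerivAt_neg t).exp.mul (((hasDerivAt_id t).add_const 3).div ?_ hden)
    refine ((((hasDerivAt_id t).pow 2).add ((hasDerivAt_id t).const_mul 4)).add_const 2).congr_deriv ?_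
    simp
  have h3 := HasDerivAt.comp u (h₂ := fun t : ℝ => Real.exp (-t) * ((t + 3) / (t ^ 2 + 4 * t + 2)))
    h2 h1
  refine ⟨_, h3, ?_⟩
  have hk : expKernel u = Real.exp (-t) * (t * (5 / 4)) := by
    rw [expKernel, ← ht, ht]; field_simp
  rw [hk]
  have : (Real.exp (-t) * (-1) * ((t + 3) / (t ^ 2 + 4 * t + 2)) + Real.exp (-t) *
        ((1 * (t ^ 2 + 4 * t + 2) - (t + 3) * (2 * t + 4)) / (t ^ 2 + 4 * t + 2) ^ 2)) *
      (-(t ^ 2 * (5 / 4))) = Real.exp (-t) * (t * (5 / 4)) *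
        (1 - 4 / (t ^ 2 + 4 * t + 2) ^ 2) := by
    field_simp
    ring
  rw [this]
  refine mul_le_of_le_one_right (by positivity) ?_
  have : 0 ≤ 4 / (t ^ 2 + 4 * t + 2) ^ 2 := by positivity
  linarith

/-- A function whose derivative is obtained from the kernel by replacing the exponential function
by a Taylor polynomial. -/
noncomputable def expPrimitiveHigh (u : ℝ) : ℝ :=
  Real.log u - ∑ k ∈ Finset.range 15,
    (-(4 / 5 / u)) ^ (k + 1) / ((k + 1 : ℝ) * ((k + 1).factorial : ℝ))

lemma hasDerivAt_expPrimitiveHigh {u : ℝ} (hu : 0 < u) :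
    ∃ d, HasDerivAt expPrimitiveHigh d u ∧ d ≤ expKernel u := by
  have h1 : HasDerivAt (fun x : ℝ => -(4 / 5 / x)) (4 / 5 / u ^ 2) u := by
    refine (((hasDerivAt_inv hu.ne').const_mul (4 / 5 : ℝ)).neg).congr_deriv ?_
    field_simp
  have h2 : ∀ k ∈ Finset.range 15, HasDerivAt
      (fun x : ℝ => (-(4 / 5 / x)) ^ (k + 1) / ((k + 1 : ℝ) * ((k + 1).factorial : ℝ)))
      (((k + 1 : ℕ) : ℝ) * (-(4 / 5 / u)) ^ (k + 1 - 1) * (4 / 5 / u ^ 2) /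
        ((k + 1 : ℝ) * ((k + 1).factorial : ℝ))) u := fun k _ =>
    (h1.pow (k + 1)).div_const _
  refine ⟨_, (Real.hasDerivAt_log hu.ne').sub (HasDerivAt.fun_sum h2), ?_⟩
  have h3 := sum_taylor_le_exp_neg (t := 4 / 5 / u) (by positivity)
  rw [Finset.sum_range_succ'] at h3
  have h4 := div_le_div_of_nonneg_right h3 hu.le
  refine le_trans (le_of_eq ?_) h4
  rw [add_div, Finset.sum_div, sub_eq_neg_add, ← Finset.sum_neg_distrib]
  congr 1
  · refine Finset.sum_congr rfl fun k _ => ?_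
    rw [Nat.add_sub_cancel, pow_succ (-(4 / 5 / u)) k]
    have : ((k + 1).factorial : ℝ) ≠ 0 := by positivity
    push_cast
    generalize (-(4 / 5 / u)) ^ k = a
    field_simp
  · simp

lemma expPrimitiveHigh_sub : (0.30046:ℝ) ≤ expPrimitiveHigh 1 - expPrimitiveHigh (1 / 4) := by
  have h : Real.log (1 / 4) = -(2 * Real.log 2) := by
    rw [one_div, Real.log_inv, show (4:ℝ) = 2 ^ 2 by norm_num, Real.log_pow]; simp
  have h2 := Real.log_two_gt_d9
  simp only [expPrimitiveHigh, h, Real.log_one]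
  norm_num [Finset.sum_range_succ, Nat.factorial]
  linarith

lemma exp_four_fifths_bounds : (2.22554:ℝ) ≤ Real.exp (4 / 5) ∧ Real.exp (4 / 5) ≤ 2.225541 := by
  have h := Real.exp_bound' (x := 4 / 5) (by norm_num) (by norm_num) (n := 12) (by norm_num)
  have h' := Real.sum_le_exp_of_nonneg (x := 4 / 5) (by norm_num) 12
  norm_num [Finset.sum_range_succ, Nat.factorial] at h h'
  constructor <;> norm_num <;> linarith

lemma exp_neg_four_fifths_bound : (0.449328:ℝ) ≤ Real.exp (-(4 / 5)) := by
  have h := exp_four_fifths_bounds.2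
  rw [Real.exp_neg, ← one_div, le_div_iff₀ (Real.exp_pos _)]
  nlinarith

lemma expPrimitiveLow_quarter : (0.01009:ℝ) ≤ expPrimitiveLow (1 / 4) := by
  have h : Real.exp (-(4 / 5 / (1 / 4))) = Real.exp (-(4 / 5)) ^ 4 := by
    rw [← Real.exp_nat_mul]; norm_num
  have h2 : (0.449328:ℝ) ^ 4 ≤ Real.exp (-(4 / 5)) ^ 4 :=
    pow_le_pow_left₀ (by norm_num) exp_neg_four_fifths_bound 4
  rw [expPrimitiveLow, h]
  norm_num at h2 ⊢
  linarith

/-- The sum that approximates the exponential integral `E₁ (4 / 5)`. -/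
noncomputable def expSum (m : ℕ) : ℝ :=
  ∑ r ∈ Finset.range m, Real.exp (-(4 / 5 * m / (r + 1))) / (r + 1)

/-- The Riemann sum is split at `1 / 4`, which is a grid point because `m` is a multiple of `4`. The
low primitive serves on the left and the high one on the right, and `0.31055 = 0.01009 + 0.30046`.
The left part starts at the first grid point, hence the term `expPrimitiveLow` at `1 / m`. -/
lemma expSum_ge {M : ℕ} (hM : 0 < M) :
    0.31055 - expPrimitiveLow (1 / (4 * M : ℕ)) - 4 / (4 * M : ℕ) ≤ expSum (4 * M) := by
  set m := 4 * M with hmdef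
  have hm : 0 < m := by omega
  have hm' : (0:ℝ) < m := Nat.cast_pos.2 hm
  have hM' : (M / m : ℝ) = 1 / 4 := by
    rw [hmdef]; push_cast
    have : (M:ℝ) ≠ 0 := by positivity
    field_simp
  have hex1 : ∀ u : ℝ, ∃ d, 0 < u → HasDerivAt expPrimitiveLow d u ∧ d ≤ expKernel u := fun u => by
    by_cases hu : 0 < u
    · obtain ⟨d, hd⟩ := hasDerivAt_expPrimitiveLow hu
      exact ⟨d, fun _ => hd⟩
    · exact ⟨0, fun h => absurd h hu⟩
  have hex2 : ∀ u : ℝ, ∃ d, 0 < u → HasDerivAt expPrimitiveHigh d u ∧ d ≤ expKernel u := fun u => by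
    by_cases hu : 0 < u
    · obtain ⟨d, hd⟩ := hasDerivAt_expPrimitiveHigh hu
      exact ⟨d, fun _ => hd⟩
    · exact ⟨0, fun h => absurd h hu⟩
  choose d1 hd1 using hex1
  choose d2 hd2 using hex2
  have hpos : ∀ (p q : ℕ), 0 < p → ∀ u ∈ Set.Icc (p / m : ℝ) (q / m), 0 < u := fun p q hp u hu =>
    (div_pos (Nat.cast_pos.2 hp) hm').trans_le hu.1
  have hlow := sub_le_sum_expKernel (m := m) (p := 1) (q := M) one_pos hM hm
    (fun u hu => (hd1 u (hpos 1 M one_pos u hu)).1) (fun u hu => (hd1 u (hpos 1 M one_pos u hu)).2)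
  have hhigh := sub_le_sum_expKernel (m := m) (p := M) (q := m) hM (by omega) hm
    (fun u hu => (hd2 u (hpos M m hM u hu)).1) (fun u hu => (hd2 u (hpos M m hM u hu)).2)
  have hsum := Finset.sum_Ico_consecutive
    (fun r : ℕ => expKernel ((r + 1 : ℕ) / m) / m + 4 / (m:ℝ) ^ 2) (m := 1) (n := M) (k := m)
    hM (by omega)
  have hsub : ∑ r ∈ Finset.Ico 1 m, (expKernel ((r + 1 : ℕ) / m) / m + 4 / (m:ℝ) ^ 2) ≤
      ∑ r ∈ Finset.range m, (expKernel ((r + 1 : ℕ) / m) / m + 4 / (m:ℝ) ^ 2) := by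
    refine Finset.sum_le_sum_of_subset_of_nonneg (fun r hr => ?_) fun r _ _ => ?_
    · exact Finset.mem_range.2 (Finset.mem_Ico.1 hr).2
    · rw [expKernel]; positivity
  have heq : ∑ r ∈ Finset.range m, (expKernel ((r + 1 : ℕ) / m) / m + 4 / (m:ℝ) ^ 2) =
      expSum m + 4 / m := by
    rw [Finset.sum_add_distrib, expSum]
    congr 1
    · refine Finset.sum_congr rfl fun r _ => ?_
      rw [expKernel]
      push_cast
      rw [show (4 / 5 / (((r:ℝ) + 1) / m)) = 4 / 5 * m / (r + 1) by field_simp]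
      field_simp
    · simp
      field_simp
  rw [hM', Nat.cast_one] at hlow
  rw [hM', div_self hm'.ne'] at hhigh
  have := expPrimitiveLow_quarter
  have := expPrimitiveHigh_sub
  norm_num at *
  linarith

/-! ### The bound 0.5801 -/

/-- Comparison of the sum with the integral of `x ^ p`; Bernoulli's inequality gives the increment
from `r` to `r + 1`. -/
lemma pow_div_le_sum_pow (p r : ℕ) :
    (r:ℝ) ^ (p + 1) / (p + 1) ≤ ∑ i ∈ Finset.range r, ((i:ℝ) + 1) ^ p := by
  induction r with
  | zero => simp
  | succ r ih =>
    rw [Finset.sum_range_succ]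
    have hb := one_add_mul_le_pow (a := -1 / ((r:ℝ) + 1)) (by
      rw [le_div_iff₀ (by positivity)]; linarith [(Nat.cast_nonneg r : (0:ℝ) ≤ r)]) (p + 1)
    have h1 : 1 + -1 / ((r:ℝ) + 1) = r / (r + 1) := by field_simp; ring
    rw [h1, div_pow] at hb
    have hpos : (0:ℝ) < ((r:ℝ) + 1) ^ (p + 1) := by positivity
    have h2 := mul_le_mul_of_nonneg_right hb hpos.le
    rw [div_mul_cancel₀ _ hpos.ne'] at h2
    have h3 : (1 + ((p + 1 : ℕ):ℝ) * (-1 / ((r:ℝ) + 1))) * ((r:ℝ) + 1) ^ (p + 1) =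
        ((r:ℝ) + 1) ^ (p + 1) - (p + 1) * ((r:ℝ) + 1) ^ p := by
      push_cast
      rw [pow_succ]
      field_simp
      ring
    rw [h3] at h2
    have h4 : ((r:ℝ) + 1) ^ (p + 1) / (p + 1) - ((r:ℝ) + 1) ^ p ≤ (r:ℝ) ^ (p + 1) / (p + 1) := by
      rw [div_sub' (by positivity)]
      gcongr
    push_cast
    linarith

/-- While the largest value so far is close to the indifference value, waiting for the next record
succeeds with at least this probability. -/
lemma optV_ge_of_mem_Icc {r : ℕ} (hr : 1000000 ≤ r) {y : ℝ}
    (hy : y ∈ Set.Icc (Real.exp (-(4 / 5 / r))) (Real.exp (-(4 / 5 / (r + 1))))) :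
    Real.exp (-(4 / 5)) * 0.9933 ≤ optV r y := by
  have hr0 : (0:ℝ) < r := by exact_mod_cast (by omega : 0 < r)
  have hy0 : 0 < y := (Real.exp_pos _).trans_le hy.1
  have hy1 : y ≤ 1 := hy.2.trans (Real.exp_le_one_iff.2 (by simp; positivity))
  refine le_trans ?_ (sum_le_optV r ⟨hy0.le, hy1⟩)
  have hpow : Real.exp (-(4 / 5)) ≤ y ^ r := by
    refine le_trans (le_of_eq ?_) (pow_le_pow_left₀ (Real.exp_pos _).le hy.1 r)
    rw [← Real.exp_nat_mul]
    congr 1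
    field_simp
  have hfac : ∀ i ∈ Finset.range r, (y ^ (r - 1 - i) - y ^ r) / ((i:ℝ) + 1) =
      y ^ r * (((y⁻¹) ^ (i + 1) - 1) / (i + 1)) := fun i hi => by
    have hi := Finset.mem_range.1 hi
    have : y ^ r = y ^ (r - 1 - i) * y ^ (i + 1) := by
      rw [← pow_add]; congr 1; omega
    rw [this, inv_pow]
    field_simp
  rw [Finset.sum_congr rfl hfac, ← Finset.mul_sum]
  refine mul_le_mul hpow ?_ (by norm_num) (pow_nonneg hy0.le _)
  set c : ℝ := 4 / 5 / (r + 1) with hc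
  have hc0 : 0 < c := by positivity
  -- Keeping the terms of degree `1` to `6` of the exponential series, and summing over `i`,
  -- approximates `∑ c ^ p / (p * p!)` at `c = 4 / 5`, which is about `0.99332`. For the optimal
  -- constant, near `0.804`, this series equals `1`.
  have hterm : ∀ i ∈ Finset.range r,
      ∑ p ∈ Finset.range 6, c ^ (p + 1) / ((p + 1).factorial : ℝ) * ((i:ℝ) + 1) ^ p ≤
      ((y⁻¹) ^ (i + 1) - 1) / (i + 1) := fun i _ => by
    have h1 : Real.exp (c * (i + 1)) ≤ (y⁻¹) ^ (i + 1) := by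
      have h0 : Real.exp c ≤ y⁻¹ := by
        rw [← neg_neg c, Real.exp_neg]
        exact inv_anti₀ hy0 hy.2
      refine le_trans (le_of_eq ?_) (pow_le_pow_left₀ (Real.exp_pos _).le h0 (i + 1))
      rw [← Real.exp_nat_mul]
      congr 1
      push_cast
      ring
    have h2 := Real.sum_le_exp_of_nonneg (x := c * (i + 1)) (by positivity) 7
    rw [Finset.sum_range_succ'] at h2
    rw [le_div_iff₀ (by positivity), Finset.sum_mul]
    have h3 : ∑ p ∈ Finset.range 6, c ^ (p + 1) / ((p + 1).factorial : ℝ) * ((i:ℝ) + 1) ^ p *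
        (i + 1) = ∑ p ∈ Finset.range 6, (c * ((i:ℝ) + 1)) ^ (p + 1) / ((p + 1).factorial : ℝ) :=
      Finset.sum_congr rfl fun p _ => by
        rw [mul_pow, pow_succ ((i:ℝ) + 1)]
        ring
    rw [h3]
    simp at h2
    linarith
  refine le_trans ?_ (Finset.sum_le_sum hterm)
  rw [Finset.sum_comm]
  simp_rw [← Finset.mul_sum]
  set ρ : ℝ := r / (r + 1) with hρ
  have hρ1 : (0.999999:ℝ) ≤ ρ := by
    rw [hρ, le_div_iff₀ (by positivity)]
    have : (1000000:ℝ) ≤ r := by exact_mod_cast hr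
    linarith
  have hlow : ∀ p ∈ Finset.range 6,
      (4 / 5) ^ (p + 1) / ((p + 1).factorial * (p + 1) : ℝ) * 0.999999 ^ (p + 1) ≤
      c ^ (p + 1) / ((p + 1).factorial : ℝ) * ∑ i ∈ Finset.range r, ((i:ℝ) + 1) ^ p := fun p _ => by
    calc _ ≤ (4 / 5) ^ (p + 1) / ((p + 1).factorial * (p + 1) : ℝ) * ρ ^ (p + 1) := by gcongr
      _ = c ^ (p + 1) / ((p + 1).factorial : ℝ) * ((r:ℝ) ^ (p + 1) / (p + 1)) := by
        rw [hρ, hc, div_pow (r : ℝ), div_pow (4 / 5 : ℝ) (r + 1 : ℝ)]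
        field_simp
      _ ≤ _ := by gcongr; exact pow_div_le_sum_pow p r
  refine le_trans ?_ (Finset.sum_le_sum hlow)
  norm_num [Finset.sum_range_succ, Nat.factorial]

/-- `optV_ge` for the thresholds with `t j ^ (m - j) = exp (-4 / 5)`. Then `t j ^ j = exp (4 / 5) *
exp (-(4 / 5) * m / (m - j))`, so both the gains and the losses become multiples of `expSum m`. -/
lemma optV_ge_expSum {m : ℕ} (hm : 1000000 < m) :
    (Real.exp (4 / 5) - 1) * expSum m + Real.exp (-(4 / 5)) * 0.9933 *
      (Real.exp (-(4 / 5 / m)) - Real.exp (-(4 / 5 / 1000000 * (m - 1000000))) -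
        4 / 5 * Real.exp (4 / 5) * expSum m) ≤ optV m 0 := by
  obtain ⟨R, hR⟩ : ∃ R : ℕ, R = 1000000 := ⟨_, rfl⟩
  rw [← hR] at hm
  set t : ℕ → ℝ := fun k => Real.exp (-(4 / 5 / (m - k : ℕ))) with ht
  set κ : ℝ := Real.exp (-(4 / 5)) * 0.9933 with hκ
  have hκ0 : 0 ≤ κ := by positivity
  have htpos : ∀ k, 0 < t k := fun k => Real.exp_pos _
  have ht1 : ∀ k, t k ≤ 1 := fun k => Real.exp_le_one_iff.2 (by simp; positivity)
  have hanti : ∀ k, k + 1 < m → t (k + 1) ≤ t k := fun k hk => by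
    refine Real.exp_le_exp.2 (neg_le_neg ?_)
    have : (0:ℝ) < (m - (k + 1) : ℕ) := by exact_mod_cast (by omega : 0 < m - (k + 1))
    gcongr
    omega
  -- With fewer than `10 ^ 6` values to come the waiting gain is estimated by `0`; this costs only
  -- the exponential term in `m - 1000000`, which vanishes in the limit.
  have hmain := optV_ge (t := t) (fun k => ⟨(htpos k).le, ht1 k⟩) m
    (H := fun r => if R ≤ r then κ else 0) hanti (fun k hk y hy => by
      split_ifs with h
      · refine optV_ge_of_mem_Icc (hR ▸ h) ?_
        convert hy using 4
        have : m - k = m - (k + 1) + 1 := by omega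
        simp only [this]
        push_cast
        rfl
      · exact optV_nonneg _ _ ⟨(htpos _).le.trans hy.1, hy.2.trans (ht1 _)⟩)
  have hm0 : (0:ℝ) < m := by exact_mod_cast (by omega : 0 < m)
  -- the immediate gains
  have hself : ∀ j ∈ Finset.range m, t j ^ j =
      Real.exp (4 / 5) * Real.exp (-(4 / 5 * m / (m - j : ℕ))) := fun j hj => by
    have hj := Finset.mem_range.1 hj
    have h0 : (0:ℝ) < (m - j : ℕ) := by exact_mod_cast (by omega : 0 < m - j)
    rw [ht, ← Real.exp_nat_mul, ← Real.exp_add]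
    congr 1
    have : (j:ℝ) = m - (m - j : ℕ) := by rw [Nat.cast_sub hj.le]; ring
    rw [this]
    field_simp
    ring
  have hrefl : ∑ j ∈ Finset.range m, t j ^ j / (m - j : ℕ) = Real.exp (4 / 5) * expSum m := by
    rw [expSum, Finset.mul_sum, ← Finset.sum_range_reflect]
    refine Finset.sum_congr rfl fun j hj => ?_
    have hj := Finset.mem_range.1 hj
    have hsub : m - (m - 1 - j) = j + 1 := by omega
    rw [hself _ (Finset.mem_range.2 (by omega)), hsub]
    push_cast
    ring
  have hA : ∑ j ∈ Finset.range m, t j ^ j * ((1 - t j ^ (m - j)) / (m - j : ℕ)) =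
      (Real.exp (4 / 5) - 1) * expSum m := by
    have : ∀ j ∈ Finset.range m, t j ^ j * ((1 - t j ^ (m - j)) / (m - j : ℕ)) =
        (1 - Real.exp (-(4 / 5))) * (t j ^ j / (m - j : ℕ)) := fun j hj => by
      have hj := Finset.mem_range.1 hj
      have h0 : (0:ℝ) < (m - j : ℕ) := by exact_mod_cast (by omega : 0 < m - j)
      have : t j ^ (m - j) = Real.exp (-(4 / 5)) := by
        rw [ht, ← Real.exp_nat_mul]
        congr 1
        field_simp
      rw [this]
      ring
    rw [Finset.sum_congr rfl this, ← Finset.mul_sum, hrefl, ← mul_assoc, sub_mul, ← Real.exp_add]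
    simp
  -- the gains from waiting
  have hB : κ * (t 0 - t (m - R) ^ (m - R + 1) - 4 / 5 * (Real.exp (4 / 5) * expSum m)) ≤
      ∑ j ∈ Finset.range (m - 1), (t j ^ (j + 1) - t (j + 1) ^ (j + 1)) *
        (if R ≤ m - (j + 1) then κ else 0) := by
    have hnn : ∀ j, j + 1 < m → 0 ≤ t j ^ (j + 1) - t (j + 1) ^ (j + 1) := fun j hj =>
      sub_nonneg.2 (pow_le_pow_left₀ (htpos _).le (hanti j hj) _)
    have hsub : ∑ j ∈ Finset.range (m - R), (t j ^ (j + 1) - t (j + 1) ^ (j + 1)) * κ ≤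
        ∑ j ∈ Finset.range (m - 1), (t j ^ (j + 1) - t (j + 1) ^ (j + 1)) *
        (if R ≤ m - (j + 1) then κ else 0) := by
      have heq : ∀ j ∈ Finset.range (m - R), (t j ^ (j + 1) - t (j + 1) ^ (j + 1)) * κ =
          (t j ^ (j + 1) - t (j + 1) ^ (j + 1)) * (if R ≤ m - (j + 1) then κ else 0) := fun j hj => by
        rw [if_pos (by have := Finset.mem_range.1 hj; omega)]
      rw [Finset.sum_congr rfl heq]
      refine Finset.sum_le_sum_of_subset_of_nonneg
        (Finset.range_subset_range.2 (by omega)) fun j hj _ => ?_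
      have hj := Finset.mem_range.1 hj
      exact mul_nonneg (hnn j (by omega)) (by split_ifs <;> simp [hκ0])
    refine le_trans ?_ hsub
    rw [← Finset.sum_mul, mul_comm]
    refine mul_le_mul_of_nonneg_right ?_ hκ0
    have htel := Finset.sum_range_sub' (fun j => t j ^ (j + 1)) (m - R)
    have hloss : ∑ j ∈ Finset.range (m - R), t (j + 1) ^ (j + 1) * (1 - t (j + 1)) ≤
        4 / 5 * (Real.exp (4 / 5) * expSum m) := by
      rw [← hrefl, Finset.mul_sum]
      have hterm : ∀ j ∈ Finset.range m, t j ^ j * (1 - t j) ≤ 4 / 5 * (t j ^ j / (m - j : ℕ)) :=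
        fun j _ => by
          have h1 : 1 - t j ≤ 4 / 5 / (m - j : ℕ) := by
            have := Real.add_one_le_exp (-(4 / 5 / (m - j : ℕ) : ℝ))
            simp only [ht]
            linarith
          calc _ ≤ t j ^ j * (4 / 5 / (m - j : ℕ)) :=
              mul_le_mul_of_nonneg_left h1 (pow_nonneg (htpos j).le _)
            _ = _ := by ring
      refine le_trans ?_ (Finset.sum_le_sum hterm)
      have hnn' : ∀ j, 0 ≤ t j ^ j * (1 - t j) := fun j =>
        mul_nonneg (pow_nonneg (htpos j).le _) (sub_nonneg.2 (ht1 j))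
      obtain ⟨m', hm'⟩ : ∃ m', m = m' + 1 := ⟨m - 1, by omega⟩
      have : ∑ j ∈ Finset.range (m' + 1), t j ^ j * (1 - t j) =
        ∑ j ∈ Finset.range m', t (j + 1) ^ (j + 1) * (1 - t (j + 1)) + t 0 ^ 0 * (1 - t 0) :=
        Finset.sum_range_succ' _ _
      have hle : ∑ j ∈ Finset.range (m - R), t (j + 1) ^ (j + 1) * (1 - t (j + 1)) ≤
          ∑ j ∈ Finset.range m', t (j + 1) ^ (j + 1) * (1 - t (j + 1)) :=
        Finset.sum_le_sum_of_subset_of_nonneg (Finset.range_subset_range.2 (by omega))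
          fun j _ _ => hnn' (j + 1)
      have hr : Finset.range m = Finset.range (m' + 1) := by rw [hm']
      rw [hr, this]
      linarith [hnn' 0]
    -- Raising the exponent of the second power by one makes the sum telescope. The correction was
    -- bounded by `1 - exp (-x) ≤ x` in `hloss`.
    have hsplit : ∑ j ∈ Finset.range (m - R), (t j ^ (j + 1) - t (j + 1) ^ (j + 1)) =
        ∑ j ∈ Finset.range (m - R), (t j ^ (j + 1) - t (j + 1) ^ (j + 1 + 1)) -
        ∑ j ∈ Finset.range (m - R), t (j + 1) ^ (j + 1) * (1 - t (j + 1)) := by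
      rw [← Finset.sum_sub_distrib]
      refine Finset.sum_congr rfl fun j _ => ?_
      rw [pow_succ (t (j + 1)) (j + 1)]
      ring
    rw [hsplit, htel]
    simp only [zero_add, pow_one]
    linarith
  have ht0 : t 0 = Real.exp (-(4 / 5 / m)) := by simp [ht]
  have htR : t (m - R) ^ (m - R + 1) ≤ Real.exp (-(4 / 5 / 1000000 * (m - 1000000))) := by
    refine (pow_le_pow_of_le_one (htpos _).le (ht1 _) (Nat.le_succ _)).trans (le_of_eq ?_)
    have : m - (m - R) = R := by omega
    have hR' : (R:ℝ) = 1000000 := by rw [hR]; norm_num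
    simp only [ht, this]
    rw [← Real.exp_nat_mul, Nat.cast_sub hm.le, hR']
    congr 1
    ring
  rw [hA] at hmain
  refine le_trans ?_ (le_trans (add_le_add_right hB _) hmain)
  rw [ht0]
  have := mul_le_mul_of_nonneg_left htR hκ0
  nlinarith

lemma le_of_tendsto_optV {α : ℝ} (h : Tendsto (fun m : ℕ => optV m 0) atTop (𝓝 α)) :
    0.5801 ≤ α := by
  have h4 : Tendsto (fun M : ℕ => 4 * M) atTop atTop :=
    tendsto_atTop_mono (fun M => by simp only [id]; omega) tendsto_id
  have hcast : Tendsto (fun M : ℕ => ((4 * M : ℕ) : ℝ)) atTop atTop :=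
    tendsto_natCast_atTop_atTop.comp h4
  have hsub := h.comp h4
  have ha : Tendsto (fun x : ℝ => Real.exp (-(4 / 5 / x))) atTop (𝓝 1) := by
    have : Tendsto (fun x : ℝ => -(4 / 5 / x)) atTop (𝓝 (-0)) :=
      (tendsto_const_nhds.div_atTop tendsto_id).neg
    simpa [Function.comp_def] using (Real.continuous_exp.tendsto _).comp this
  have hb : Tendsto (fun x : ℝ => Real.exp (-(4 / 5 / 1000000 * (x - 1000000)))) atTop (𝓝 0) := by
    refine Real.tendsto_exp_neg_atTop_nhds_zero.comp (Tendsto.const_mul_atTop (by norm_num) ?_)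
    exact tendsto_atTop_add_const_right _ _ tendsto_id
  have hc : Tendsto (fun x : ℝ => expPrimitiveLow (1 / x)) atTop (𝓝 0) := by
    have hexp : Tendsto (fun x : ℝ => 2 * Real.exp (-(4 / 5 * x))) atTop (𝓝 (2 * 0)) :=
      (Real.tendsto_exp_neg_atTop_nhds_zero.comp
        (Tendsto.const_mul_atTop (by norm_num) tendsto_id)).const_mul 2
    rw [mul_zero] at hexp
    refine tendsto_of_tendsto_of_tendsto_of_le_of_le' tendsto_const_nhds hexp ?_ ?_
    · filter_upwards [eventually_gt_atTop 0] with x hx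
      rw [expPrimitiveLow]
      positivity
    · filter_upwards [eventually_gt_atTop 0] with x hx
      have hx1 : 4 / 5 / (1 / x) = 4 / 5 * x := by field_simp
      rw [expPrimitiveLow, hx1, mul_comm]
      gcongr
      rw [div_le_iff₀ (by positivity)]
      nlinarith
  have hd : Tendsto (fun x : ℝ => 4 / x) atTop (𝓝 0) := tendsto_const_nhds.div_atTop tendsto_id
  set e := Real.exp (4 / 5) with he
  have hκe : Real.exp (-(4 / 5)) * e = 1 := by rw [he, ← Real.exp_add]; simp
  have hlim : Tendsto (fun x : ℝ => Real.exp (-(4 / 5)) * 0.9933 * (Real.exp (-(4 / 5 / x)) -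
      Real.exp (-(4 / 5 / 1000000 * (x - 1000000)))) +
      (0.31055 - expPrimitiveLow (1 / x) - 4 / x) * (e - 1 - 0.79464)) atTop
      (𝓝 (Real.exp (-(4 / 5)) * 0.9933 * (1 - 0) + (0.31055 - 0 - 0) * (e - 1 - 0.79464))) :=
    ((ha.sub hb).const_mul _).add (((hc.const_sub _).sub hd).mul_const _)
  have hle := le_of_tendsto_of_tendsto (hlim.comp hcast) hsub (by
    filter_upwards [eventually_gt_atTop 1000000] with M hM
    have h1 := expSum_ge (M := M) (by omega)
    have h2 := optV_ge_expSum (m := 4 * M) (by omega)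
    simp only [Function.comp]
    refine le_trans ?_ h2
    -- `0.79464 = 0.8 * 0.9933`. The total coefficient of `expSum` is `e - 1 - 0.79464`, and its
    -- sign allows the lower bound for `expSum` to be inserted.
    have hcoef : 0 ≤ e - 1 - 0.79464 := by
      have := exp_four_fifths_bounds.1
      rw [← he] at this
      norm_num at this ⊢
      linarith
    have h3 := mul_le_mul_of_nonneg_right h1 hcoef
    have h4 : Real.exp (-(4 / 5)) * 0.9933 * (4 / 5 * e * expSum (4 * M)) =
        0.79464 * expSum (4 * M) := by
      linear_combination 0.79464 * expSum (4 * M) * hκe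
    rw [← he]
    linarith)
  have h5 := exp_four_fifths_bounds.1
  have h6 := exp_neg_four_fifths_bound
  rw [← he] at h5
  norm_num at h5 h6 hle ⊢
  linarith

/-! ### Atomless distributions and product measures -/

lemma continuous_cdf (μ : Measure ℝ) [IsProbabilityMeasure μ] [NullSingletonClass μ] :
    Continuous (ProbabilityTheory.cdf μ) := by
  refine continuous_iff_continuousAt.2 fun x => ?_
  rw [(ProbabilityTheory.monotone_cdf μ).continuousAt_iff_leftLim_eq_rightLim,
    StieltjesFunction.rightLim_eq]
  have h := (ProbabilityTheory.cdf μ).measure_singleton x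
  rw [ProbabilityTheory.measure_cdf, measure_singleton, eq_comm, ENNReal.ofReal_eq_zero] at h
  exact le_antisymm ((ProbabilityTheory.monotone_cdf μ).leftLim_le le_rfl) (by linarith)

lemma cdf_eq_real_Iio (μ : Measure ℝ) [IsProbabilityMeasure μ] [NullSingletonClass μ] (x : ℝ) :
    μ.real (Set.Iio x) = ProbabilityTheory.cdf μ x := by
  rw [ProbabilityTheory.cdf_eq_real]
  exact measureReal_congr Iio_ae_eq_Iic

lemma exists_cdf_eq (μ : Measure ℝ) [IsProbabilityMeasure μ] [NullSingletonClass μ] {a : ℝ}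
    (h0 : 0 < a) (h1 : a < 1) : ∃ x, ProbabilityTheory.cdf μ x = a := by
  obtain ⟨y, hy⟩ := ((ProbabilityTheory.tendsto_cdf_atBot μ).eventually (gt_mem_nhds h0)).exists
  obtain ⟨z, hz⟩ := ((ProbabilityTheory.tendsto_cdf_atTop μ).eventually (lt_mem_nhds h1)).exists
  exact mem_range_of_exists_le_of_exists_ge (continuous_cdf μ) ⟨y, hy.le⟩ ⟨z, hz.le⟩

/-- The probability integral transform. -/
lemma map_cdf_eq_volume (μ : Measure ℝ) [IsProbabilityMeasure μ] [NullSingletonClass μ] :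
    μ.map (ProbabilityTheory.cdf μ) = volume.restrict (Set.Icc 0 1) := by
  have hmeas : Measurable (ProbabilityTheory.cdf μ) := (continuous_cdf μ).measurable
  have : IsProbabilityMeasure (μ.map (ProbabilityTheory.cdf μ)) :=
    Measure.isProbabilityMeasure_map hmeas.aemeasurable
  refine Measure.ext_of_Iic _ _ fun a => ?_
  rw [Measure.map_apply hmeas measurableSet_Iic, Measure.restrict_apply measurableSet_Iic]
  rcases lt_or_ge a 0 with ha | ha
  · have h1 : ProbabilityTheory.cdf μ ⁻¹' Set.Iic a = ∅ := by
      ext x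
      simpa using ha.trans_le (ProbabilityTheory.cdf_nonneg μ x)
    have h2 : Set.Iic a ∩ Set.Icc (0:ℝ) 1 = ∅ := by
      ext x
      simp only [Set.mem_inter_iff, Set.mem_Iic, Set.mem_Icc, Set.mem_empty_iff_false, iff_false]
      intro h
      linarith [h.1, h.2.1]
    rw [h1, h2, measure_empty, measure_empty]
  rcases le_or_gt 1 a with ha1 | ha1
  · have h1 : ProbabilityTheory.cdf μ ⁻¹' Set.Iic a = Set.univ := by
      ext x
      simpa using (ProbabilityTheory.cdf_le_one μ x).trans ha1
    have h2 : Set.Iic a ∩ Set.Icc (0:ℝ) 1 = Set.Icc 0 1 :=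
      Set.inter_eq_right.2 fun x hx => hx.2.trans ha1
    rw [h1, h2, measure_univ]
    simp
  have h2 : Set.Iic a ∩ Set.Icc (0:ℝ) 1 = Set.Icc 0 a := by
    ext x
    simp only [Set.mem_inter_iff, Set.mem_Iic, Set.mem_Icc]
    constructor
    · exact fun h => ⟨h.2.1, h.1⟩
    · exact fun h => ⟨h.2, h.1, h.2.trans ha1.le⟩
  rw [h2, Real.volume_Icc, sub_zero]
  refine le_antisymm ?_ ?_
  · refine ENNReal.le_of_forall_pos_le_add fun ε hε _ => ?_
    by_cases hb : a + ε < 1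
    · obtain ⟨y, hy⟩ := exists_cdf_eq μ (a := a + ε) (by positivity) hb
      calc μ (ProbabilityTheory.cdf μ ⁻¹' Set.Iic a) ≤ μ (Set.Iic y) := by
            refine measure_mono fun x hx => ?_
            by_contra hxy
            have := ProbabilityTheory.monotone_cdf μ (not_le.1 hxy).le
            have hx : ProbabilityTheory.cdf μ x ≤ a := hx
            have hε' : (0:ℝ) < ε := hε
            linarith
        _ = ENNReal.ofReal (a + ε) := by rw [← ProbabilityTheory.ofReal_cdf, hy]
        _ = ENNReal.ofReal a + ε := by
          rw [ENNReal.ofReal_add ha ε.coe_nonneg, ENNReal.ofReal_coe_nnreal]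
    · calc μ (ProbabilityTheory.cdf μ ⁻¹' Set.Iic a) ≤ 1 := prob_le_one
        _ ≤ ENNReal.ofReal (a + ε) := by
          rw [← ENNReal.ofReal_one]
          exact ENNReal.ofReal_le_ofReal (not_lt.1 hb)
        _ = ENNReal.ofReal a + ε := by
          rw [ENNReal.ofReal_add ha ε.coe_nonneg, ENNReal.ofReal_coe_nnreal]
  · rcases ha.eq_or_lt with h | h
    · simp [← h]
    · obtain ⟨y, hy⟩ := exists_cdf_eq μ h ha1
      rw [← hy, ProbabilityTheory.ofReal_cdf]
      exact measure_mono fun x hx => ProbabilityTheory.monotone_cdf μ hx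

lemma integral_comp_cdf (μ : Measure ℝ) [IsProbabilityMeasure μ] [NullSingletonClass μ]
    {φ : ℝ → ℝ} (hφ : Measurable φ) :
    ∫ x, φ (ProbabilityTheory.cdf μ x) ∂μ = ∫ u in (0:ℝ)..1, φ u := by
  rw [← integral_map (continuous_cdf μ).measurable.aemeasurable hφ.aestronglyMeasurable,
    map_cdf_eq_volume, intervalIntegral.integral_of_le zero_le_one, integral_Icc_eq_integral_Ioc]

/-- Fubini: once the value of coordinate `i` is fixed, the other coordinates are independent and
their constraints decouple. -/
lemma pi_slice {n : ℕ} (D : Fin (n + 1) → Measure ℝ) [∀ i, IsProbabilityMeasure (D i)]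
    (i : Fin (n + 1)) {A : Set ℝ} (hA : MeasurableSet A) {B : Fin (n + 1) → ℝ → Set ℝ}
    (hB : ∀ l, MeasurableSet {p : ℝ × ℝ | p.2 ∈ B l p.1}) :
    Measure.pi D {x | x i ∈ A ∧ ∀ l, l ≠ i → x l ∈ B l (x i)} =
      ∫⁻ v in A, ∏ j, D (i.succAbove j) (B (i.succAbove j) v) ∂(D i) := by
  have hmp := measurePreserving_piFinSuccAbove D i
  let S : Set (ℝ × (Fin n → ℝ)) := {p | p.1 ∈ A ∧ ∀ j, p.2 j ∈ B (i.succAbove j) p.1}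
  have hS : MeasurableSet S := by
    refine (measurable_fst hA).inter ?_
    have : {p : ℝ × (Fin n → ℝ) | ∀ j, p.2 j ∈ B (i.succAbove j) p.1} =
        ⋂ j, (fun p : ℝ × (Fin n → ℝ) => (p.1, p.2 j)) ⁻¹' {p | p.2 ∈ B (i.succAbove j) p.1} := by
      ext p; simp
    change MeasurableSet {p : ℝ × (Fin n → ℝ) | ∀ j, p.2 j ∈ B (i.succAbove j) p.1}
    rw [this]
    exact MeasurableSet.iInter fun j =>
      (measurable_fst.prodMk ((measurable_pi_apply j).comp measurable_snd)) (hB _)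
  have hset : {x : Fin (n + 1) → ℝ | x i ∈ A ∧ ∀ l, l ≠ i → x l ∈ B l (x i)} =
      MeasurableEquiv.piFinSuccAbove (fun _ => ℝ) i ⁻¹' S := by
    ext x
    refine and_congr Iff.rfl ⟨fun h j => h _ (Fin.succAbove_ne i j), fun h l hl => ?_⟩
    obtain ⟨j, rfl⟩ := Fin.exists_succAbove_eq hl
    exact h j
  rw [hset, hmp.measure_preimage_equiv, Measure.prod_apply hS, ← lintegral_indicator hA]
  refine lintegral_congr fun v => ?_
  by_cases hv : v ∈ A
  · rw [Set.indicator_of_mem hv, ← Measure.pi_pi]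
    congr 1
    ext y
    simp [S, hv]
  · rw [Set.indicator_of_notMem hv]
    have : Prod.mk v ⁻¹' S = ∅ := by
      ext y
      simp [S, hv]
    rw [this, measure_empty]

lemma measurable_measure_slice (μ : Measure ℝ) [IsProbabilityMeasure μ] {B : ℝ → Set ℝ}
    (hB : MeasurableSet {p : ℝ × ℝ | p.2 ∈ B p.1}) : Measurable fun v => μ (B v) :=
  measurable_measure_prodMk_left hB

lemma measurable_measureReal_slice (μ : Measure ℝ) [IsProbabilityMeasure μ] {B : ℝ → Set ℝ}
    (hB : MeasurableSet {p : ℝ × ℝ | p.2 ∈ B p.1}) : Measurable fun v => μ.real (B v) :=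
  (measurable_measure_slice μ hB).ennreal_toReal

lemma pi_real_slice {n : ℕ} (D : Fin (n + 1) → Measure ℝ) [∀ i, IsProbabilityMeasure (D i)]
    (i : Fin (n + 1)) {A : Set ℝ} (hA : MeasurableSet A) {B : Fin (n + 1) → ℝ → Set ℝ}
    (hB : ∀ l, MeasurableSet {p : ℝ × ℝ | p.2 ∈ B l p.1}) :
    (Measure.pi D).real {x | x i ∈ A ∧ ∀ l, l ≠ i → x l ∈ B l (x i)} =
      ∫ v in A, ∏ j, (D (i.succAbove j)).real (B (i.succAbove j) v) ∂(D i) := by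
  rw [measureReal_def, pi_slice D i hA hB, integral_eq_lintegral_of_nonneg_ae
    (Eventually.of_forall fun v => Finset.prod_nonneg fun _ _ => measureReal_nonneg)
    (Finset.measurable_prod _ fun j _ =>
      measurable_measureReal_slice _ (hB _)).aestronglyMeasurable]
  congr 1
  refine lintegral_congr fun v => ?_
  rw [ENNReal.ofReal_prod_of_nonneg fun _ _ => measureReal_nonneg]
  exact Finset.prod_congr rfl fun j _ => (ofReal_measureReal (measure_ne_top _ _)).symm

lemma ae_injective_pi {n : ℕ} (D : Fin n → Measure ℝ) [∀ i, IsProbabilityMeasure (D i)]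
    [∀ i, NullSingletonClass (D i)] : ∀ᵐ x ∂(Measure.pi D), Function.Injective x := by
  have h : ∀ i j : Fin n, i ≠ j → ∀ᵐ x ∂(Measure.pi D), x j ≠ x i := by
    intro i j hij
    cases n with
    | zero => exact i.elim0
    | succ n =>
      have hB : ∀ l, MeasurableSet {p : ℝ × ℝ | p.2 ∈ (if l = j then {p.1} else Set.univ : Set ℝ)} := by
        intro l
        split_ifs
        · exact measurableSet_eq_fun measurable_snd measurable_fst
        · exact MeasurableSet.univ
      have := pi_slice D i (A := Set.univ) MeasurableSet.univ
        (B := fun l v => if l = j then {v} else Set.univ) hB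
      have hzero : ∀ v, ∏ l, D (i.succAbove l)
          (if i.succAbove l = j then {v} else Set.univ : Set ℝ) = 0 := fun v => by
        obtain ⟨l, hl⟩ := Fin.exists_succAbove_eq hij.symm
        refine Finset.prod_eq_zero (Finset.mem_univ l) ?_
        rw [if_pos hl, measure_singleton]
      simp only [hzero, lintegral_zero] at this
      rw [ae_iff]
      refine measure_mono_null (fun x hx => ?_) this
      have hx : x j = x i := not_not.1 hx
      refine ⟨Set.mem_univ _, fun l _ => ?_⟩
      split_ifs with hlj
      · rw [hlj]; exact hx
      · trivial
  have h' : ∀ᵐ x ∂(Measure.pi D), ∀ i j : Fin n, i ≠ j → x j ≠ x i := by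
    rw [ae_all_iff]; intro i
    rw [ae_all_iff]; intro j
    by_cases hij : i = j
    · exact Eventually.of_forall fun x h => absurd hij h
    · filter_upwards [h i j hij] with x hx _ using hx
  filter_upwards [h'] with x hx i j hij
  by_contra hne
  exact hx i j hne hij.symm

lemma cdf_mem_Icc (μ : Measure ℝ) (x : ℝ) : ProbabilityTheory.cdf μ x ∈ Set.Icc (0:ℝ) 1 :=
  ⟨ProbabilityTheory.cdf_nonneg μ x, ProbabilityTheory.cdf_le_one μ x⟩

lemma integrable_comp_cdf (μ : Measure ℝ) [IsProbabilityMeasure μ] [NullSingletonClass μ]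
    {φ : ℝ → ℝ} (hφ : Measurable φ) {C : ℝ} (hC : ∀ u ∈ Set.Icc (0:ℝ) 1, |φ u| ≤ C) :
    Integrable (fun x => φ (ProbabilityTheory.cdf μ x)) μ :=
  Integrable.of_bound (hφ.comp (continuous_cdf μ).measurable).aestronglyMeasurable C
    (Eventually.of_forall fun x => hC _ (cdf_mem_Icc μ x))

/-! ### Optimality of the dynamic program for arbitrary record thresholds -/

/-- Conditioning on the first of `m + 1` i.i.d. values, compared with the recursion of `optV`. -/
lemma pi_real_le_optV_succ (μ : Measure ℝ) [IsProbabilityMeasure μ] [NullSingletonClass μ] {m : ℕ}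
    {S : Set (Fin (m + 1) → ℝ)} {T : ℝ → Set (Fin m → ℝ)} {a : ℝ} (ha : a ∈ Set.Icc (0:ℝ) 1)
    (hT : MeasurableSet {p : ℝ × (Fin m → ℝ) | p.2 ∈ T p.1})
    (hS : ∀ x ∈ S, (fun j => x (Fin.succ j)) ∈ T (x 0))
    (hlow : ∀ y, ProbabilityTheory.cdf μ y < a →
      (Measure.pi fun _ : Fin m => μ).real (T y) ≤ optV m a)
    (hhigh : ∀ y, a ≤ ProbabilityTheory.cdf μ y → (Measure.pi fun _ : Fin m => μ).real (T y) ≤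
      max (ProbabilityTheory.cdf μ y ^ m) (optV m (ProbabilityTheory.cdf μ y))) :
    (Measure.pi fun _ : Fin (m + 1) => μ).real S ≤ optV (m + 1) a := by
  -- The integrand of the recursion: an observation below the old record leaves the state unchanged,
  -- any other one offers a choice.
  set φ : ℝ → ℝ := fun u => if u < a then optV m a else max (u ^ m) (optV m u) with hφ
  have hmp := measurePreserving_piFinSuccAbove (fun _ : Fin (m + 1) => μ) 0
  have hsub : S ⊆ MeasurableEquiv.piFinSuccAbove (fun _ => ℝ) 0 ⁻¹'
      {p : ℝ × (Fin m → ℝ) | p.2 ∈ T p.1} := fun x hx => by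
    have := hS x hx
    change (fun j => x (Fin.succAbove 0 j)) ∈ T (x 0)
    simpa only [Fin.succAbove_zero] using this
  have hcm := continuous_max_optV m
  have hφm : Measurable φ :=
    Measurable.ite measurableSet_Iio measurable_const hcm.measurable
  obtain ⟨C, hC⟩ := (isCompact_Icc (a := (0:ℝ)) (b := 1)).exists_bound_of_continuousOn
    hcm.continuousOn
  have hφi : Integrable (fun x => φ (ProbabilityTheory.cdf μ x)) μ := by
    refine integrable_comp_cdf μ hφm (C := |optV m a| + C) fun u hu => ?_
    have h1 := hC u hu
    have h2 := abs_nonneg (optV m a)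
    have h3 := (norm_nonneg _).trans h1
    simp only [hφ]
    split_ifs
    · linarith
    · rw [Real.norm_eq_abs] at h1
      linarith
  calc (Measure.pi fun _ : Fin (m + 1) => μ).real S
      ≤ (Measure.pi fun _ : Fin (m + 1) => μ).real
        (MeasurableEquiv.piFinSuccAbove (fun _ => ℝ) 0 ⁻¹' {p : ℝ × (Fin m → ℝ) | p.2 ∈ T p.1}) :=
        measureReal_mono hsub
    _ = ∫ y, (Measure.pi fun _ : Fin m => μ).real (T y) ∂μ := by
        rw [measureReal_def, hmp.measure_preimage_equiv, Measure.prod_apply hT, ← integral_toReal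
          (measurable_measure_prodMk_left hT).aemeasurable
          (Eventually.of_forall fun _ => measure_lt_top _ _)]
        rfl
    _ ≤ ∫ y, φ (ProbabilityTheory.cdf μ y) ∂μ := by
        refine integral_mono_of_nonneg (Eventually.of_forall fun _ => measureReal_nonneg) hφi
          (Eventually.of_forall fun y => ?_)
        simp only [hφ]
        split_ifs with h
        · exact hlow y h
        · exact hhigh y (not_lt.1 h)
    _ = ∫ u in (0:ℝ)..1, φ u := integral_comp_cdf μ hφm
    _ = optV (m + 1) a := by
        have h1 : ∫ u in (0:ℝ)..a, φ u = a * optV m a := by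
          rw [intervalIntegral.integral_congr_uIoo (g := fun _ => optV m a)]
          · simp
          · intro u hu
            rw [Set.uIoo_of_le ha.1] at hu
            simp [hφ, hu.2]
        have h2 : ∫ u in a..1, φ u = ∫ u in a..1, max (u ^ m) (optV m u) := by
          refine intervalIntegral.integral_congr_uIoo fun u hu => ?_
          rw [Set.uIoo_of_le ha.2] at hu
          simp [hφ, hu.1.le.not_gt]
        have hi : IntervalIntegrable φ volume 0 1 := by
          rw [intervalIntegrable_iff_integrableOn_Icc_of_le zero_le_one, IntegrableOn,
            ← map_cdf_eq_volume μ]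
          exact (integrable_map_measure hφm.aestronglyMeasurable
            (continuous_cdf μ).measurable.aemeasurable).2 hφi
        rw [← intervalIntegral.integral_add_adjacent_intervals (b := a), h1, h2]
        · rfl
        · exact hi.mono_set (by
            rw [Set.uIcc_of_le ha.1, Set.uIcc_of_le zero_le_one]
            exact Set.Icc_subset_Icc_right ha.2)
        · exact hi.mono_set (by
            rw [Set.uIcc_of_le ha.2, Set.uIcc_of_le zero_le_one]
            exact Set.Icc_subset_Icc_left ha.1)

/-- The record rule, run on `x` after values whose maximum is `v`, selects the overall maximum. -/
def RecordWinsFrom (v : ℝ) {m : ℕ} (σ x : Fin m → ℝ) : Prop :=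
  ∃ k, (σ k ≤ x k ∧ v ≤ x k) ∧ (∀ j, x j ≤ x k) ∧
    ∀ j < k, ¬ ((σ j ≤ x j ∧ v ≤ x j) ∧ ∀ i < j, x i ≤ x j)

lemma measurableSet_recordWinsFrom {m : ℕ} (σ : Fin m → ℝ) :
    MeasurableSet {p : ℝ × (Fin m → ℝ) | RecordWinsFrom p.1 σ p.2} := by
  have hx : ∀ j : Fin m, Measurable fun p : ℝ × (Fin m → ℝ) => p.2 j := fun j =>
    (measurable_pi_apply j).comp measurable_snd
  have hσ : ∀ j, Measurable fun p : ℝ × (Fin m → ℝ) => σ j ≤ p.2 j := fun j =>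
    measurableSet_setOfPred.1 (measurableSet_le measurable_const (hx j))
  have hv : ∀ j, Measurable fun p : ℝ × (Fin m → ℝ) => p.1 ≤ p.2 j := fun j =>
    measurableSet_setOfPred.1 (measurableSet_le measurable_fst (hx j))
  have hle : ∀ i j, Measurable fun p : ℝ × (Fin m → ℝ) => p.2 i ≤ p.2 j := fun i j =>
    measurableSet_setOfPred.1 (measurableSet_le (hx i) (hx j))
  refine measurableSet_setOfPred.2 (Measurable.exists fun k => ((hσ k).and (hv k)).and
    ((Measurable.forall fun j => hle j k).and (Measurable.forall fun j =>
      measurable_const.imp ?_)))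
  exact (((hσ j).and (hv j)).and (Measurable.forall fun i => measurable_const.imp (hle i j))).not

lemma RecordWinsFrom.of_lt {v : ℝ} {m : ℕ} {σ x : Fin (m + 1) → ℝ} (h : RecordWinsFrom v σ x)
    (h0 : x 0 < v) : RecordWinsFrom v (fun j => σ j.succ) fun j => x j.succ := by
  obtain ⟨k, hk, hmax, hno⟩ := h
  rcases Fin.eq_zero_or_eq_succ k with rfl | ⟨k, rfl⟩
  · exact absurd hk.2 (not_le.2 h0)
  refine ⟨k, hk, fun j => hmax _, fun j hj hacc => hno j.succ (Fin.succ_lt_succ_iff.2 hj)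
    ⟨hacc.1, fun i hi => ?_⟩⟩
  rcases Fin.eq_zero_or_eq_succ i with rfl | ⟨i, rfl⟩
  · exact h0.le.trans hacc.1.2
  · exact hacc.2 i (Fin.succ_lt_succ_iff.1 hi)

lemma RecordWinsFrom.of_le {v : ℝ} {m : ℕ} {σ x : Fin (m + 1) → ℝ} (h : RecordWinsFrom v σ x)
    (h0 : v ≤ x 0) : (σ 0 ≤ x 0 ∧ ∀ j : Fin m, x j.succ ≤ x 0) ∨
      (x 0 < σ 0 ∧ RecordWinsFrom (x 0) (fun j => σ j.succ) fun j => x j.succ) := by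
  obtain ⟨k, hk, hmax, hno⟩ := h
  rcases Fin.eq_zero_or_eq_succ k with rfl | ⟨k, rfl⟩
  · exact Or.inl ⟨hk.1, fun j => hmax _⟩
  have hσ : x 0 < σ 0 := by
    by_contra hle
    exact hno 0 (Fin.succ_pos k) ⟨⟨not_lt.1 hle, h0⟩, fun i hi => absurd hi (Fin.not_lt_zero i)⟩
  refine Or.inr ⟨hσ, k, ⟨hk.1, hmax 0⟩, fun j => hmax _,
    fun j hj hacc => hno j.succ (Fin.succ_lt_succ_iff.2 hj)
    ⟨⟨hacc.1.1, h0.trans hacc.1.2⟩, fun i hi => ?_⟩⟩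
  rcases Fin.eq_zero_or_eq_succ i with rfl | ⟨i, rfl⟩
  · exact hacc.1.2
  · exact hacc.2 i (Fin.succ_lt_succ_iff.1 hi)

lemma pi_real_forall_le (μ : Measure ℝ) [IsProbabilityMeasure μ] (m : ℕ) (y : ℝ) :
    (Measure.pi fun _ : Fin m => μ).real {x | ∀ j, x j ≤ y} = ProbabilityTheory.cdf μ y ^ m := by
  have : {x : Fin m → ℝ | ∀ j, x j ≤ y} = Set.univ.pi fun _ => Set.Iic y := by
    ext x; simp [Pi.le_def]
  rw [this, measureReal_def, Measure.pi_pi, ENNReal.toReal_prod, ProbabilityTheory.cdf_eq_real]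
  simp [measureReal_def]

lemma measurableSet_firstStep {m : ℕ} (s : ℝ) (σ : Fin m → ℝ) :
    MeasurableSet {p : ℝ × (Fin m → ℝ) |
      (s ≤ p.1 ∧ ∀ j, p.2 j ≤ p.1) ∨ (p.1 < s ∧ RecordWinsFrom p.1 σ p.2)} := by
  refine measurableSet_setOfPred.2 (Measurable.or (Measurable.and ?_ (Measurable.forall fun j => ?_))
    (Measurable.and ?_ ?_))
  · exact measurableSet_setOfPred.1 (measurableSet_le measurable_const measurable_fst)
  · exact measurableSet_setOfPred.1 (measurableSet_le
      ((measurable_pi_apply j).comp measurable_snd) measurable_fst)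
  · exact measurableSet_setOfPred.1 (measurableSet_lt measurable_fst measurable_const)
  · exact measurableSet_setOfPred.1 (measurableSet_recordWinsFrom σ)

/-- Once `y` is observed, the threshold selects one of the two alternatives, and each is bounded by
one argument of the maximum. -/
lemma firstStep_real_le (μ : Measure ℝ) [IsProbabilityMeasure μ] {m : ℕ} (s : ℝ) (σ : Fin m → ℝ)
    {y : ℝ} (h : (Measure.pi fun _ : Fin m => μ).real {x | RecordWinsFrom y σ x} ≤
      optV m (ProbabilityTheory.cdf μ y)) :
    (Measure.pi fun _ : Fin m => μ).real
      {x | (s ≤ y ∧ ∀ j, x j ≤ y) ∨ (y < s ∧ RecordWinsFrom y σ x)} ≤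
      max (ProbabilityTheory.cdf μ y ^ m) (optV m (ProbabilityTheory.cdf μ y)) := by
  by_cases hs : s ≤ y
  · refine le_max_of_le_left (le_trans (measureReal_mono fun x hx => ?_)
      (pi_real_forall_le μ m y).le)
    rcases hx with hx | hx
    · exact hx.2
    · exact absurd hx.1 (not_lt.2 hs)
  · refine le_max_of_le_right (le_trans (measureReal_mono fun x hx => ?_) h)
    rcases hx with hx | hx
    · exact absurd hx.1 hs
    · exact hx.2

lemma recordWinsFrom_real_le (μ : Measure ℝ) [IsProbabilityMeasure μ] [NullSingletonClass μ]
    (m : ℕ) : ∀ (v : ℝ) (σ : Fin m → ℝ),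
    (Measure.pi fun _ : Fin m => μ).real {x | RecordWinsFrom v σ x} ≤
      optV m (ProbabilityTheory.cdf μ v) := by
  induction m with
  | zero =>
    intro v σ
    have : {x : Fin 0 → ℝ | RecordWinsFrom v σ x} = ∅ := by
      ext x
      simp only [Set.mem_ofPred_eq, Set.mem_empty_iff_false, iff_false]
      rintro ⟨k, -⟩
      exact k.elim0
    simp [this, optV]
  | succ m ih =>
    intro v σ
    refine pi_real_le_optV_succ μ (cdf_mem_Icc μ v)
      (T := fun y => {x | (y < v ∧ RecordWinsFrom v (fun j => σ j.succ) x) ∨ (v ≤ y ∧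
        ((σ 0 ≤ y ∧ ∀ j, x j ≤ y) ∨ (y < σ 0 ∧ RecordWinsFrom y (fun j => σ j.succ) x)))})
      ?_ (fun x hx => ?_) (fun y hy => ?_) fun y hy => ?_
    · refine measurableSet_setOfPred.2 (Measurable.or (Measurable.and ?_ ?_) (Measurable.and ?_ ?_))
      · exact measurableSet_setOfPred.1 (measurableSet_lt measurable_fst measurable_const)
      · exact measurableSet_setOfPred.1 ((measurable_const.prodMk measurable_snd)
          (measurableSet_recordWinsFrom fun j => σ j.succ))
      · exact measurableSet_setOfPred.1 (measurableSet_le measurable_const measurable_fst)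
      · exact measurableSet_setOfPred.1 (measurableSet_firstStep (σ 0) fun j => σ j.succ)
    · rcases lt_or_ge (x 0) v with h | h
      · exact Or.inl ⟨h, RecordWinsFrom.of_lt hx h⟩
      · exact Or.inr ⟨h, RecordWinsFrom.of_le hx h⟩
    · have hyv : y < v := by
        by_contra h
        exact absurd (ProbabilityTheory.monotone_cdf μ (not_lt.1 h)) (not_le.2 hy)
      refine le_trans (measureReal_mono fun x hx => ?_) (ih v fun j => σ j.succ)
      rcases hx with hx | hx
      · exact hx.2
      · exact absurd hx.1 (not_le.2 hyv)
    · rcases lt_or_ge y v with hyv | hyv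
      -- On a flat piece of the distribution function, `y` may lie below `v` at the same level; then
      -- `y` is no record, but the bound for continuing from `v` is also that for `y`.
      · have heq := le_antisymm (ProbabilityTheory.monotone_cdf μ hyv.le) hy
        rw [heq]
        refine le_max_of_le_right (le_trans (measureReal_mono fun x hx => ?_)
          (ih v fun j => σ j.succ))
        rcases hx with hx | hx
        · exact hx.2
        · exact absurd hx.1 (not_le.2 hyv)
      · refine le_trans (measureReal_mono fun x hx => ?_)
          (firstStep_real_le μ (σ 0) (fun j => σ j.succ) (ih y fun j => σ j.succ))
        rcases hx with hx | hx
        · exact absurd hx.1 (not_lt.2 hyv)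
        · exact hx.2

/-- No record rule on `m` i.i.d. values does better than `optV m 0`. -/
lemma iidSuccess_record_le (μ : Measure ℝ) [IsProbabilityMeasure μ] [NullSingletonClass μ] {m : ℕ}
    (σ : Fin m → ℝ) : iidSuccess ThresholdRule.record μ σ ≤ optV m 0 := by
  have hwin : ∀ {m : ℕ} {σ x : Fin m → ℝ}, ThresholdRule.record.SelectsMax σ x →
      ∃ k, (σ k ≤ x k ∧ ∀ j, x j ≤ x k) ∧ ∀ j < k, ¬ (σ j ≤ x j ∧ ∀ i < j, x i ≤ x j) := by
    rintro m σ x ⟨k, ⟨hk, hno⟩, hmax⟩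
    exact ⟨k, ⟨hk.1, hmax⟩, hno⟩
  cases m with
  | zero =>
    have : {x : Fin 0 → ℝ | ThresholdRule.record.SelectsMax σ x} = ∅ := by
      ext x
      simp only [Set.mem_ofPred_eq, Set.mem_empty_iff_false, iff_false]
      rintro ⟨k, -⟩
      exact k.elim0
    simp [iidSuccess, this, optV]
  | succ m =>
    refine pi_real_le_optV_succ μ (a := 0) (by simp)
      (T := fun y => {x | (σ 0 ≤ y ∧ ∀ j, x j ≤ y) ∨
        (y < σ 0 ∧ RecordWinsFrom y (fun j => σ j.succ) x)})
      (measurableSet_firstStep (σ 0) fun j => σ j.succ) (fun x hx => ?_)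
      (fun y hy => absurd (ProbabilityTheory.cdf_nonneg μ y) (not_le.2 hy))
      fun y _ => firstStep_real_le μ _ _ (recordWinsFrom_real_le μ m y _)
    obtain ⟨k, ⟨hk, hmax⟩, hno⟩ := hwin hx
    have h : RecordWinsFrom (x 0) σ x :=
      ⟨k, ⟨hk, hmax 0⟩, hmax, fun j hj hacc => hno j hj ⟨hacc.1.1, hacc.2⟩⟩
    exact h.of_le le_rfl

/-! ### Success probabilities as slot integrals -/

/-- For i.i.d. uniform values, the probability that the value of step `K` is the largest and at
least `a`, and that the value of each earlier step `j` is below `g j`. -/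
noncomputable def slotValue {m : ℕ} (K : Fin m) (a : ℝ) (g : Fin m → ℝ) : ℝ :=
  ∫ w in a..1, w ^ (m - 1 - K : ℕ) * ∏ j ∈ Finset.Iio K, min (g j) w

lemma prod_succAbove_ite {m : ℕ} (K : Fin (m + 1)) (f : Fin (m + 1) → ℝ) (w : ℝ) :
    ∏ j : Fin m, (if K.succAbove j < K then f (K.succAbove j) else w) =
      w ^ (m + 1 - 1 - K : ℕ) * ∏ j ∈ Finset.Iio K, f j := by
  have h1 : ∏ j : Fin m, (if K.succAbove j < K then f (K.succAbove j) else w) =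
      ∏ l ∈ ({K}ᶜ : Finset (Fin (m + 1))), if l < K then f l else w := by
    rw [← Fin.image_succAbove_univ, Finset.prod_image fun a _ b _ h => Fin.succAbove_right_injective h]
  have h2 : ({K}ᶜ : Finset (Fin (m + 1))) = Finset.Ioi K ∪ Finset.Iio K := by
    ext l
    simp [eq_comm]
  have h3 : Disjoint (Finset.Ioi K) (Finset.Iio K) := by
    rw [Finset.disjoint_left]
    intro l h h'
    exact absurd (Finset.mem_Ioi.1 h) (not_lt.2 (Finset.mem_Iio.1 h').le)
  rw [h1, h2, Finset.prod_union h3]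
  congr 1
  · rw [Finset.prod_congr rfl fun l hl =>
      if_neg (not_lt.2 (Finset.mem_Ioi.1 hl).le), Finset.prod_const, Fin.card_Ioi]
  · exact Finset.prod_congr rfl fun l hl => if_pos (Finset.mem_Iio.1 hl)

lemma continuous_slot_integrand {m : ℕ} (K : Fin m) (g : Fin m → ℝ) :
    Continuous fun w : ℝ => w ^ (m - 1 - K : ℕ) * ∏ j ∈ Finset.Iio K, min (g j) w := by
  fun_prop

/-- Only the inclusion of `v ≥ t` in `cdf μ v ≥ cdf μ t` is used, so flat pieces of the distribution
function do no harm. -/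
lemma setIntegral_comp_cdf_le (μ : Measure ℝ) [IsProbabilityMeasure μ] [NullSingletonClass μ]
    {ψ : ℝ → ℝ} (hψ : Continuous ψ) (h0 : ∀ u ∈ Set.Icc (0:ℝ) 1, 0 ≤ ψ u) (t : ℝ) :
    ∫ v in Set.Ici t, ψ (ProbabilityTheory.cdf μ v) ∂μ ≤
      ∫ u in (ProbabilityTheory.cdf μ t)..1, ψ u := by
  set a := ProbabilityTheory.cdf μ t with ha
  have ha' : a ∈ Set.Icc (0:ℝ) 1 := cdf_mem_Icc μ t
  obtain ⟨C, hC⟩ := (isCompact_Icc (a := (0:ℝ)) (b := 1)).exists_bound_of_continuousOn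
    hψ.continuousOn
  have hm : Measurable ((Set.Ici a).indicator ψ) := hψ.measurable.indicator measurableSet_Ici
  have hint : Integrable (fun v => (Set.Ici a).indicator ψ (ProbabilityTheory.cdf μ v)) μ := by
    refine integrable_comp_cdf μ hm (C := C) fun u hu => ?_
    exact (norm_indicator_le_norm_self ψ u).trans (hC u hu)
  rw [← integral_indicator measurableSet_Ici]
  calc ∫ v, (Set.Ici t).indicator (fun v => ψ (ProbabilityTheory.cdf μ v)) v ∂μ
      ≤ ∫ v, (Set.Ici a).indicator ψ (ProbabilityTheory.cdf μ v) ∂μ := by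
        refine integral_mono_of_nonneg (Eventually.of_forall fun v => ?_) hint
          (Eventually.of_forall fun v => ?_)
        · exact Set.indicator_nonneg (fun v _ => h0 _ (cdf_mem_Icc μ v)) v
        · by_cases hv : v ∈ Set.Ici t
          · have : ProbabilityTheory.cdf μ v ∈ Set.Ici a := ProbabilityTheory.monotone_cdf μ hv
            simp only [Set.indicator_of_mem hv, Set.indicator_of_mem this]
            exact le_rfl
          · simp only [Set.indicator_of_notMem hv]
            exact Set.indicator_apply_nonneg fun _ => h0 _ (cdf_mem_Icc μ v)
    _ = ∫ u in (0:ℝ)..1, (Set.Ici a).indicator ψ u := integral_comp_cdf μ hm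
    _ = ∫ u in a..1, ψ u := by
        rw [intervalIntegral.integral_of_le zero_le_one, intervalIntegral.integral_of_le ha'.2,
          ← integral_Icc_eq_integral_Ioc, ← integral_Icc_eq_integral_Ioc,
          setIntegral_indicator measurableSet_Ici]
        congr 2
        ext u
        simp only [Set.mem_inter_iff, Set.mem_Icc, Set.mem_Ici]
        exact ⟨fun h => ⟨h.2, h.1.2⟩, fun h => ⟨⟨ha'.1.trans h.1, h.2⟩, h.1⟩⟩

lemma slot_real_le (μ : Measure ℝ) [IsProbabilityMeasure μ] [NullSingletonClass μ] {m : ℕ}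
    (σ : Fin m → ℝ) (K : Fin m) :
    (Measure.pi fun _ : Fin m => μ).real {x | x K ∈ Set.Ici (σ K) ∧ ∀ l, l ≠ K →
      x l ∈ (if l < K then Set.Iio (σ l) ∩ Set.Iic (x K) else Set.Iic (x K))} ≤
      slotValue K (ProbabilityTheory.cdf μ (σ K)) fun j => ProbabilityTheory.cdf μ (σ j) := by
  cases m with
  | zero => exact K.elim0
  | succ m =>
    have hB : ∀ l, MeasurableSet {p : ℝ × ℝ | p.2 ∈
        (if l < K then Set.Iio (σ l) ∩ Set.Iic p.1 else Set.Iic p.1 : Set ℝ)} := by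
      intro l
      have h1 : MeasurableSet {p : ℝ × ℝ | p.2 ≤ p.1} :=
        measurableSet_le measurable_snd measurable_fst
      split_ifs
      · exact (measurableSet_lt measurable_snd measurable_const).inter h1
      · exact h1
    rw [pi_real_slice (fun _ => μ) K measurableSet_Ici
      (B := fun l v => if l < K then Set.Iio (σ l) ∩ Set.Iic v else Set.Iic v) hB]
    have hle : ∀ v, ∏ j : Fin m, μ.real (if K.succAbove j < K then
        Set.Iio (σ (K.succAbove j)) ∩ Set.Iic v else Set.Iic v) ≤
        ∏ j : Fin m, (if K.succAbove j < K then
          min (ProbabilityTheory.cdf μ (σ (K.succAbove j))) (ProbabilityTheory.cdf μ v)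
          else ProbabilityTheory.cdf μ v) := fun v => by
      refine Finset.prod_le_prod (fun _ _ => measureReal_nonneg) fun j _ => ?_
      split_ifs
      · refine le_min ?_ ?_
        · rw [← cdf_eq_real_Iio]
          exact measureReal_mono Set.inter_subset_left
        · rw [ProbabilityTheory.cdf_eq_real μ v]
          exact measureReal_mono Set.inter_subset_right
      · rw [ProbabilityTheory.cdf_eq_real μ v]
    have hc := continuous_slot_integrand K fun j => ProbabilityTheory.cdf μ (σ j)
    refine le_trans ?_ (setIntegral_comp_cdf_le μ hc (fun u hu => ?_) (σ K))
    · refine integral_mono_of_nonneg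
        (Eventually.of_forall fun v => Finset.prod_nonneg fun _ _ => measureReal_nonneg) ?_
        (Eventually.of_forall fun v => ?_)
      · obtain ⟨C, hC⟩ := (isCompact_Icc (a := (0:ℝ)) (b := 1)).exists_bound_of_continuousOn
          hc.continuousOn
        exact (integrable_comp_cdf μ hc.measurable hC).restrict
      · refine (hle v).trans (le_of_eq ?_)
        exact prod_succAbove_ite K
          (fun l => min (ProbabilityTheory.cdf μ (σ l)) (ProbabilityTheory.cdf μ v)) _
    · exact mul_nonneg (pow_nonneg hu.1 _) (Finset.prod_nonneg fun j _ =>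
        le_min (cdf_mem_Icc μ _).1 hu.1)

/-- The success probability of a plain rule on `m` i.i.d. values. -/
lemma iidSuccess_plain_le (μ : Measure ℝ) [IsProbabilityMeasure μ] [NullSingletonClass μ] {m : ℕ}
    (σ : Fin m → ℝ) : iidSuccess ThresholdRule.plain μ σ ≤ ∑ K, slotValue K
      (ProbabilityTheory.cdf μ (σ K)) fun j => ProbabilityTheory.cdf μ (σ j) := by
  refine le_trans (le_trans (measureReal_mono fun x hx => ?_) (measureReal_iUnion_fintype_le _))
    (Finset.sum_le_sum fun K _ => slot_real_le μ σ K)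
  obtain ⟨K, ⟨hK, hno⟩, hmax⟩ := hx
  refine Set.mem_iUnion.2 ⟨K, hK, fun l _ => ?_⟩
  split_ifs with hl
  · exact ⟨not_le.1 (hno l hl), hmax l⟩
  · exact hmax l

/-- The objective of the rule with thresholds `s` on `m` i.i.d. uniform values; for the record rule
this is its success probability only if the thresholds are antitone. -/
noncomputable def ThresholdRule.value (r : ThresholdRule) {m : ℕ} (s : Fin m → ℝ) : ℝ :=
  match r with
  | .plain => ∑ K, slotValue K (s K) s
  | .record => ∑ K : Fin m, if (K:ℕ) = 0 then slotValue K (s K) 0 else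
      (∑ J ∈ Finset.Iio K, slotValue K (s K) fun _ => s J) / (K:ℕ)

lemma recordValue_eq_value (m : ℕ) (s : ℕ → ℝ) :
    recordValue m s = ThresholdRule.record.value fun k : Fin m => s k := by
  rw [recordValue, Finset.sum_range]
  refine Finset.sum_congr rfl fun K _ => ?_
  split_ifs with hK
  · refine intervalIntegral.integral_congr fun w _ => ?_
    have : Finset.Iio K = ∅ := by
      ext j
      simp [Fin.lt_def, hK]
    simp [skipProb, hK, this]
  · simp only [slotValue]
    rw [← intervalIntegral.integral_finsetSum (f := fun (J : Fin m) (w : ℝ) =>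
        w ^ (m - 1 - K : ℕ) * ∏ j ∈ Finset.Iio K, min (s J) w) fun J _ =>
      (continuous_slot_integrand K fun _ => s J).intervalIntegrable _ _,
      ← intervalIntegral.integral_div]
    refine intervalIntegral.integral_congr fun w _ => ?_
    have hsum : ∑ J ∈ Finset.Iio K, min (s J) w ^ (K:ℕ) =
        ∑ J ∈ Finset.range K, min (s J) w ^ (K:ℕ) := by
      rw [← Nat.Iio_eq_range, ← Fin.map_valEmbedding_Iio, Finset.sum_map]
      rfl
    simp only [skipProb, if_neg hK, Finset.prod_const, Fin.card_Iio, ← Finset.mul_sum, hsum,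
      mul_div_assoc]

lemma continuous_slotValue {X : Type*} [TopologicalSpace X] {m : ℕ} (K : Fin m) {a : X → ℝ}
    {g : X → Fin m → ℝ} (ha : Continuous a) (hg : Continuous g) :
    Continuous fun x => slotValue K (a x) (g x) := by
  have h : (fun x => slotValue K (a x) (g x)) = fun x => -∫ w in (1:ℝ)..a x,
      w ^ (m - 1 - K : ℕ) * ∏ j ∈ Finset.Iio K, min (g x j) w := by
    funext x
    rw [slotValue, intervalIntegral.integral_symm]
  rw [h]
  refine (intervalIntegral.continuous_parametric_intervalIntegral_of_continuous ?_ ha).neg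
  have : ∀ j, Continuous fun p : X × ℝ => g p.1 j := fun j =>
    (continuous_apply j).comp (hg.comp continuous_fst)
  simp only [Function.uncurry_def]
  fun_prop

lemma ThresholdRule.continuous_value (r : ThresholdRule) (m : ℕ) :
    Continuous fun s : Fin m → ℝ => r.value s := by
  cases r with
  | plain =>
    exact continuous_finsetSum _ fun K _ => continuous_slotValue K (continuous_apply K) continuous_id
  | record =>
    refine continuous_finsetSum _ fun K _ => ?_
    split_ifs
    · exact continuous_slotValue K (continuous_apply K) continuous_const
    · exact (continuous_finsetSum _ fun J _ => continuous_slotValue K (continuous_apply K)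
        (continuous_pi fun _ => continuous_apply J)).div_const _

/-- Thresholds may be moved into the open unit interval at an arbitrarily small loss. -/
lemma ThresholdRule.exists_interior_value (r : ThresholdRule) {m : ℕ} {s : Fin m → ℝ}
    (hs : ∀ k, s k ∈ Set.Icc (0:ℝ) 1) {δ : ℝ} (hδ : 0 < δ) :
    ∃ s' : Fin m → ℝ, (∀ k, s' k ∈ Set.Ioo (0:ℝ) 1) ∧ (Antitone s → Antitone s') ∧
      r.value s - δ ≤ r.value s' := by
  have hc : Continuous fun t : ℝ => r.value fun k => (1 - t) * s k + t / 2 :=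
    (r.continuous_value m).comp (by fun_prop)
  have hlim : Tendsto (fun t : ℝ => r.value fun k => (1 - t) * s k + t / 2) (𝓝[>] 0)
      (𝓝 (r.value s)) := by
    have := (hc.tendsto 0).mono_left (nhdsWithin_le_nhds (s := Set.Ioi (0:ℝ)))
    simpa using this
  obtain ⟨t, ht, ht0, ht1⟩ := ((hlim.eventually (lt_mem_nhds (sub_lt_self _ hδ))).and
    (Ioo_mem_nhdsGT (zero_lt_one' ℝ))).exists
  refine ⟨_, fun k => ⟨?_, ?_⟩, fun hanti i j hij => ?_, ht.le⟩
  · have := mul_nonneg (sub_nonneg.2 ht1.le) (hs k).1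
    linarith
  · have := mul_le_mul_of_nonneg_left (hs k).2 (sub_nonneg.2 ht1.le)
    linarith
  · have := mul_le_mul_of_nonneg_left (hanti hij) (sub_nonneg.2 ht1.le)
    linarith

/-! ### Random blocks -/

/-- Item `l` has a value `x l` that is acceptable for its block `b l`: it reaches the threshold of
the block and, for the record rule, is not exceeded in any earlier block. -/
def ThresholdRule.BlockAccepts (r : ThresholdRule) {n m : ℕ} (τ : Fin m → ℝ) (b : Fin n → Fin m)
    (x : Fin n → ℝ) (l : Fin n) : Prop :=
  match r with
  | .plain => τ (b l) ≤ x l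
  | .record => τ (b l) ≤ x l ∧ ∀ j, b j < b l → x j ≤ x l

/-- The item `i` reaches the threshold of its block and no item of an earlier block is
acceptable. -/
def ThresholdRule.BlockReaches (r : ThresholdRule) {n m : ℕ} (τ : Fin m → ℝ) (b : Fin n → Fin m)
    (x : Fin n → ℝ) (i : Fin n) : Prop :=
  τ (b i) ≤ x i ∧ ∀ l, b l < b i → ¬ r.BlockAccepts τ b x l

/-- The largest item reaches the threshold of its block, and no other item of this block or of an
earlier one is acceptable. -/
def ThresholdRule.BlockSelects (r : ThresholdRule) {n m : ℕ} (τ : Fin m → ℝ) (b : Fin n → Fin m)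
    (x : Fin n → ℝ) : Prop :=
  ∃ i, (∀ j, x j ≤ x i) ∧ τ (b i) ≤ x i ∧ ∀ l, l ≠ i → b l ≤ b i → ¬ r.BlockAccepts τ b x l

/-- If the items are revealed block by block, the rule that gives each step the threshold of its
block succeeds, in whatever order the items of a block are revealed. -/
lemma ThresholdRule.BlockSelects.selectsMax {r : ThresholdRule} {n m : ℕ} {τ : Fin m → ℝ}
    {b : Fin n → Fin m} {x : Fin n → ℝ} (h : r.BlockSelects τ b x) {π : Equiv.Perm (Fin n)}
    (hmono : Monotone (b ∘ π)) : r.SelectsMax (τ ∘ b ∘ π) (fun k => x (π k)) := by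
  obtain ⟨i, hmax, hτ, hno⟩ := h
  refine ⟨π.symm i, ⟨?_, fun j hj hacc => ?_⟩, fun j => by simpa using hmax _⟩
  · cases r with
    | plain => simpa [ThresholdRule.Accepts] using hτ
    | record => exact ⟨by simpa using hτ, fun j _ => by simpa using hmax _⟩
  · have hne : π j ≠ i := fun h => by
      rw [← h] at hj
      simp at hj
    have hle : b (π j) ≤ b i := by simpa using hmono hj.le
    refine hno (π j) hne hle ?_
    cases r with
    | plain => exact hacc
    | record =>
      refine ⟨hacc.1, fun l hl => ?_⟩
      have hlt : π.symm l < j := by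
        by_contra hge
        have := hmono (not_lt.1 hge)
        simp only [Function.comp_apply, Equiv.apply_symm_apply] at this
        exact absurd hl (not_lt.2 this)
      simpa using hacc.2 _ hlt

/-- For fixed labels of the other items, at most one label of `i` reaches without selecting. If `b`
fails to select because of an acceptable item in a block up to `b i`, then moving `i` to a later
block leaves that item acceptable, and it now precedes `i`. Hence the labels of the other `n` items
determine a bad assignment. -/
lemma card_blockReaches_le (r : ThresholdRule) {n m : ℕ} (τ : Fin m → ℝ) {x : Fin (n + 1) → ℝ}
    {i : Fin (n + 1)} (hi : ∀ j, x j ≤ x i) :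
    Nat.card {b // r.BlockReaches τ b x i} ≤ Nat.card {b // r.BlockSelects τ b x} + m ^ n := by
  classical
  simp only [Nat.card_eq_fintype_card, Fintype.card_subtype]
  set R := Finset.univ.filter fun b : Fin (n + 1) → Fin m => r.BlockReaches τ b x i with hR
  set S := Finset.univ.filter fun b : Fin (n + 1) → Fin m => r.BlockSelects τ b x with hS
  have hsub : R.card ≤ S.card + (R \ S).card := by
    rw [← Finset.card_union_of_disjoint Finset.disjoint_sdiff]
    exact Finset.card_le_card fun b hb => by
      by_cases h : b ∈ S <;> simp [h, hb]
  refine hsub.trans (Nat.add_le_add_left ?_ _)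
  have hcard : (Finset.univ : Finset (Fin n → Fin m)).card = m ^ n := by simp
  rw [← hcard]
  have key : ∀ b ∈ R \ S, ∀ b' ∈ R \ S,
      (∀ l, l ≠ i → b l = b' l) → ¬ b i < b' i := by
    intro b hb b' hb' heq hlt
    simp only [hR, hS, Finset.mem_sdiff, Finset.mem_filter, Finset.mem_univ, true_and] at hb hb'
    have hex : ∃ l, l ≠ i ∧ b l ≤ b i ∧ r.BlockAccepts τ b x l := by
      by_contra! hnot
      exact hb.2 ⟨i, hi, hb.1.1, hnot⟩
    obtain ⟨l, hl, hle, hacc⟩ := hex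
    refine hb'.1.2 l (by rw [← heq l hl]; exact hle.trans_lt hlt) ?_
    cases r with
    | plain =>
      have hacc : τ (b l) ≤ x l := hacc
      exact (heq l hl ▸ hacc : τ (b' l) ≤ x l)
    | record =>
      refine ⟨heq l hl ▸ hacc.1, fun j hj => ?_⟩
      rw [← heq l hl] at hj
      by_cases hji : j = i
      · subst hji
        exact absurd (hj.trans_le hle) (not_lt.2 hlt.le)
      · exact hacc.2 j (heq j hji ▸ hj)
  refine Finset.card_le_card_of_injOn (fun b j => b (i.succAbove j)) (fun _ _ => by simp)
    fun b hb b' hb' hbb' => ?_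
  have heq : ∀ l, l ≠ i → b l = b' l := fun l hl => by
    obtain ⟨j, rfl⟩ := Fin.exists_succAbove_eq hl
    exact congrFun hbb' j
  funext l
  by_cases hl : l = i
  · subst hl
    exact le_antisymm (not_lt.1 (key b' hb' b hb fun l hl => (heq l hl).symm))
      (not_lt.1 (key b hb b' hb' heq))
  · exact heq l hl

/-- Relabelling the largest item of the blocks before `K` uniformly. -/
lemma sum_card_le_mul_card_blockReaches {n m : ℕ} {τ : Fin m → ℝ} (hτ : Antitone τ)
    {x : Fin n → ℝ} (hx : Function.Injective x) (i : Fin n) (K : Fin m) (hK : τ K ≤ x i) :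
    ∑ J ∈ Finset.Iio K, Nat.card {b : Fin n → Fin m // b i = K ∧ ∀ l, b l < K → x l < τ J} ≤
      K * Nat.card {b // b i = K ∧ ThresholdRule.record.BlockReaches τ b x i} := by
  classical
  simp only [Nat.card_eq_fintype_card, Fintype.card_subtype]
  have hcardK : (Finset.Iio K).card = K := Fin.card_Iio K
  rw [← Finset.card_sigma]
  have hprod : (K : ℕ) * (Finset.univ.filter fun b : Fin n → Fin m =>
      b i = K ∧ ThresholdRule.record.BlockReaches τ b x i).card =
      ((Finset.Iio K).sigma fun _ => Finset.univ.filter fun b : Fin n → Fin m =>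
      b i = K ∧ ThresholdRule.record.BlockReaches τ b x i).card := by
    rw [Finset.card_sigma, Finset.sum_const, hcardK, smul_eq_mul]
  rw [hprod]
  have htop : ∀ s : Finset (Fin n), ∃ l, s.Nonempty → l ∈ s ∧ ∀ l' ∈ s, x l' ≤ x l := fun s => by
    by_cases hs : s.Nonempty
    · obtain ⟨l, hl⟩ := s.exists_max_image x hs
      exact ⟨l, fun _ => hl⟩
    · exact ⟨i, fun h => absurd h hs⟩
  choose top htop using htop
  let early : (Fin n → Fin m) → Finset (Fin n) := fun b => Finset.univ.filter fun l => b l < K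
  -- Exchange `J` with the label of the largest early item. This item stays early, so its identity
  -- is preserved and the exchange is an involution.
  let φ : (Σ _ : Fin m, Fin n → Fin m) → Σ _ : Fin m, Fin n → Fin m := fun p =>
    if (early p.2).Nonempty then
      ⟨p.2 (top (early p.2)), Function.update p.2 (top (early p.2)) p.1⟩ else p
  have hearly : ∀ (b : Fin n → Fin m) (J : Fin m), J < K → (early b).Nonempty →
      early (Function.update b (top (early b)) J) = early b := by
    intro b J hJ hne
    ext l
    simp only [early, Finset.mem_filter, Finset.mem_univ, true_and, Function.update_apply]
    split_ifs with h
    · have := (htop (early b) hne).1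
      simp only [early, Finset.mem_filter, Finset.mem_univ, true_and] at this
      simp only [hJ, true_iff, h]
      exact this
    · rfl
  have hinv : ∀ p : (Σ _ : Fin m, Fin n → Fin m), p.1 < K → φ (φ p) = p := by
    rintro ⟨J, b⟩ hJ
    by_cases hne : (early b).Nonempty
    · have he := hearly b J hJ hne
      simp only [φ, if_pos hne, he]
      simp
    · simp only [φ, if_neg hne]
  refine Finset.card_le_card_of_injOn φ (fun p hp => ?_) fun p hp q hq hpq => ?_
  · obtain ⟨J, b⟩ := p
    simp only [Finset.coe_sigma, Set.mem_sigma_iff, Finset.coe_Iio, Set.mem_Iio, Finset.coe_filter,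
      Finset.mem_univ, true_and, Set.mem_ofPred_eq] at hp ⊢
    obtain ⟨hJ, hbi, hlow⟩ := hp
    by_cases hne : (early b).Nonempty
    · have he := hearly b J hJ hne
      obtain ⟨hmem, hmax⟩ := htop (early b) hne
      simp only [φ, if_pos hne]
      set t := top (early b)
      have hbt : b t < K := by simpa [early] using hmem
      have hti : i ≠ t := fun h => by
        rw [← h, hbi] at hbt
        exact lt_irrefl _ hbt
      set b' := Function.update b t J with hb'
      have hb'i : b' i = K := by simp [hb', Function.update_of_ne hti, hbi]
      have hb't : b' t = J := by simp [hb']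
      refine ⟨hbt, hb'i, hb'i ▸ hK, fun l hl hacc => ?_⟩
      rw [hb'i] at hl
      have hl' : l ∈ early b := by
        rw [← he]
        simpa [early] using hl
      have h1 : x l ≤ x t := hmax l hl'
      have h2 : x t < τ J := hlow t hbt
      -- If `l` were in no later block than `t`, antitone thresholds would give `x l ≥ τ J > x t ≥ x
      -- l`. So `t` precedes `l`, and the record condition on `l` forces `l = t`.
      have h3 : b' t < b' l := by
        by_contra hle
        have := hτ (not_lt.1 hle)
        rw [hb't] at this
        linarith [hacc.1]
      have h4 : l = t := hx (le_antisymm h1 (hacc.2 t h3))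
      rw [h4] at h3
      exact lt_irrefl _ h3
    · simp only [φ, if_neg hne]
      refine ⟨hJ, hbi, hbi ▸ hK, fun l hl _ => hne ⟨l, ?_⟩⟩
      rw [hbi] at hl
      simpa [early] using hl
  · simp only [Finset.coe_sigma, Set.mem_sigma_iff, Finset.coe_Iio, Set.mem_Iio] at hp hq
    rw [← hinv p hp.1, ← hinv q hq.1, hpq]

lemma measurableSet_blockSelects (r : ThresholdRule) {n m : ℕ} (τ : Fin m → ℝ)
    (b : Fin n → Fin m) : MeasurableSet {x | r.BlockSelects τ b x} := by
  have hle : ∀ i j : Fin n, Measurable fun x : Fin n → ℝ => x i ≤ x j := fun i j =>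
    measurableSet_setOfPred.1 (measurableSet_le (measurable_pi_apply i) (measurable_pi_apply j))
  have hτ : ∀ (c : ℝ) (j : Fin n), Measurable fun x : Fin n → ℝ => c ≤ x j := fun c j =>
    measurableSet_setOfPred.1 (measurableSet_le measurable_const (measurable_pi_apply j))
  have hacc : ∀ l, Measurable fun x => r.BlockAccepts τ b x l := fun l => by
    cases r with
    | plain => exact hτ _ _
    | record => exact (hτ _ _).and (Measurable.forall fun j => measurable_const.imp (hle j l))
  exact measurableSet_setOfPred.2 (Measurable.exists fun i => (Measurable.forall fun j => hle j i).and
    ((hτ _ _).and (Measurable.forall fun l => measurable_const.imp (measurable_const.imp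
      (hacc l).not))))

/-- If blocks are assigned to the items uniformly and independently, the sizes of the blocks do not
depend on the order in which the items are revealed; hence some sizes are as good as the average. -/
lemma exists_secretarySuccess_ge (r : ThresholdRule) {n m : ℕ} (hm : 0 < m) (D : Fin n → Measure ℝ)
    [∀ i, IsProbabilityMeasure (D i)] (τ : Fin m → ℝ) :
    ∃ τ' : Fin n → ℝ, (∑ b : Fin n → Fin m, (Measure.pi D).real {x | r.BlockSelects τ b x}) / m ^ n ≤
      secretarySuccess r D τ' := by
  have : Nonempty (Fin n → Fin m) := ⟨fun _ => ⟨0, hm⟩⟩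
  by_contra! hcon
  have hfac : (0:ℝ) < n.factorial := by positivity
  -- Here `u` labels steps rather than items; sorting it yields the blocks of consecutive steps. The
  -- average over `u` is compared with the average over the labels of items.
  have hlt : ∑ u : Fin n → Fin m, secretarySuccess r D (τ ∘ u ∘ Tuple.sort u) <
      ∑ _u : Fin n → Fin m,
        (∑ b : Fin n → Fin m, (Measure.pi D).real {x | r.BlockSelects τ b x}) / m ^ n :=
    Finset.sum_lt_sum_of_nonempty Finset.univ_nonempty fun u _ => hcon _
  refine absurd hlt (not_lt.2 ?_)
  simp only [Finset.sum_const, Finset.card_univ, Fintype.card_fun, Fintype.card_fin, nsmul_eq_mul,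
    Nat.cast_pow]
  rw [mul_div_cancel₀ _ (by positivity)]
  simp only [secretarySuccess]
  rw [← Finset.sum_div, le_div_iff₀ hfac]
  calc (∑ b : Fin n → Fin m, (Measure.pi D).real {x | r.BlockSelects τ b x}) * n.factorial
      = ∑ ρ : Equiv.Perm (Fin n), ∑ u : Fin n → Fin m,
          (Measure.pi D).real {x | r.BlockSelects τ (u ∘ ρ) x} := by
        have : ∀ ρ : Equiv.Perm (Fin n), ∑ u : Fin n → Fin m,
            (Measure.pi D).real {x | r.BlockSelects τ (u ∘ ρ) x} =
            ∑ b : Fin n → Fin m, (Measure.pi D).real {x | r.BlockSelects τ b x} := fun ρ =>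
          (Equiv.arrowCongr ρ.symm (Equiv.refl (Fin m))).sum_comp
            fun b => (Measure.pi D).real {x | r.BlockSelects τ b x}
        simp_rw [this]
        simp [Fintype.card_perm, mul_comm]
    _ = ∑ u : Fin n → Fin m, ∑ ρ : Equiv.Perm (Fin n),
          (Measure.pi D).real {x | r.BlockSelects τ (u ∘ ρ) x} := Finset.sum_comm
    -- Reindex so that, under the order `π`, the item revealed at step `k` carries the sorted label
    -- of step `k`.
    _ = ∑ u : Fin n → Fin m, ∑ π : Equiv.Perm (Fin n),
          (Measure.pi D).real {x | r.BlockSelects τ (u ∘ Tuple.sort u ∘ π.symm) x} := by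
        refine Finset.sum_congr rfl fun u _ => ?_
        refine (Fintype.sum_equiv ((Equiv.inv _).trans (Equiv.mulLeft (Tuple.sort u))) _ _
          fun π => ?_).symm
        rfl
    _ ≤ _ := by
        refine Finset.sum_le_sum fun u _ => Finset.sum_le_sum fun π _ => measureReal_mono fun x hx => ?_
        have hmono : Monotone ((u ∘ Tuple.sort u ∘ π.symm) ∘ π) := by
          have : (u ∘ Tuple.sort u ∘ π.symm) ∘ π = u ∘ Tuple.sort u := by
            funext k; simp
          rw [this]
          exact Tuple.monotone_sort u
        have := ThresholdRule.BlockSelects.selectsMax hx hmono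
        have heq : τ ∘ (u ∘ Tuple.sort u ∘ π.symm) ∘ π = τ ∘ u ∘ Tuple.sort u := by
          funext k; simp
        rw [heq] at this
        exact this

/-! ### The law of the maximum -/

/-- The distribution of the maximum of independent values with distributions `D`. -/
noncomputable def maxLaw {n : ℕ} (D : Fin (n + 1) → Measure ℝ) : Measure ℝ :=
  (Measure.pi D).map fun x => Finset.univ.sup' Finset.univ_nonempty x

lemma measurable_sup_univ (n : ℕ) :
    Measurable fun x : Fin (n + 1) → ℝ => Finset.univ.sup' Finset.univ_nonempty x := by
  have : (fun x : Fin (n + 1) → ℝ => Finset.univ.sup' Finset.univ_nonempty x) =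
      Finset.univ.sup' Finset.univ_nonempty fun i (x : Fin (n + 1) → ℝ) => x i := by
    funext x
    rw [Finset.sup'_apply]
  rw [this]
  exact Finset.measurable_sup' _ fun i _ => measurable_pi_apply i

section MaxLaw

variable {n : ℕ} (D : Fin (n + 1) → Measure ℝ) [∀ i, IsProbabilityMeasure (D i)]

instance isProbabilityMeasure_maxLaw : IsProbabilityMeasure (maxLaw D) :=
  Measure.isProbabilityMeasure_map (measurable_sup_univ n).aemeasurable

instance nullSingletonClass_maxLaw [∀ i, NullSingletonClass (D i)] :
    NullSingletonClass (maxLaw D) where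
  measure_singleton y := by
    rw [maxLaw, Measure.map_apply (measurable_sup_univ n) (measurableSet_singleton y)]
    refine measure_mono_null (t := ⋃ i, {x | x i = y}) (fun x hx => ?_)
      (measure_iUnion_null fun i => Measure.pi_hyperplane D i y)
    obtain ⟨i, -, hi⟩ := Finset.exists_mem_eq_sup' Finset.univ_nonempty x
    exact Set.mem_iUnion.2 ⟨i, hi.symm.trans hx⟩

lemma cdf_maxLaw (y : ℝ) :
    ProbabilityTheory.cdf (maxLaw D) y = ∏ i, ProbabilityTheory.cdf (D i) y := by
  have hset : (fun x : Fin (n + 1) → ℝ => Finset.univ.sup' Finset.univ_nonempty x) ⁻¹' Set.Iic y =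
      Set.univ.pi fun _ => Set.Iic y := by
    ext x
    simp [Pi.le_def]
  rw [ProbabilityTheory.cdf_eq_real, measureReal_def, maxLaw,
    Measure.map_apply (measurable_sup_univ n) measurableSet_Iic, hset, Measure.pi_pi,
    ENNReal.toReal_prod]
  exact Finset.prod_congr rfl fun i _ => (ProbabilityTheory.cdf_eq_real (D i) y).symm

/-- Split according to the item that attains the maximum; given its value, the others lie below
independently. A union bound suffices, so ties need no discussion. -/
lemma maxLaw_le_sum_withDensity : maxLaw D ≤ ∑ i, (D i).withDensity fun v =>
    ENNReal.ofReal (∏ j, ProbabilityTheory.cdf (D (i.succAbove j)) v) := by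
  refine Measure.le_iff.2 fun S hS => ?_
  rw [Measure.finsetSum_apply, maxLaw, Measure.map_apply (measurable_sup_univ n) hS]
  have hsub : (fun x : Fin (n + 1) → ℝ => Finset.univ.sup' Finset.univ_nonempty x) ⁻¹' S ⊆
      ⋃ i, {x | x i ∈ S ∧ ∀ l, l ≠ i → x l ∈ Set.Iic (x i)} := fun x hx => by
    obtain ⟨i, -, hi⟩ := Finset.exists_mem_eq_sup' Finset.univ_nonempty x
    have hx : Finset.univ.sup' Finset.univ_nonempty x ∈ S := hx
    refine Set.mem_iUnion.2 ⟨i, hi ▸ hx, fun l _ => ?_⟩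
    change x l ≤ x i
    rw [← hi]
    exact Finset.le_sup' x (Finset.mem_univ l)
  refine (measure_mono hsub).trans ((measure_iUnion_fintype_le _ _).trans ?_)
  refine Finset.sum_le_sum fun i _ => le_of_eq ?_
  rw [pi_slice D i hS (B := fun _ v => Set.Iic v)
    (fun _ => measurableSet_le measurable_snd measurable_fst), withDensity_apply _ hS]
  refine lintegral_congr fun v => ?_
  rw [ENNReal.ofReal_prod_of_nonneg fun _ _ => ProbabilityTheory.cdf_nonneg _ _]
  exact Finset.prod_congr rfl fun j _ => (ProbabilityTheory.ofReal_cdf _ v).symm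

lemma setIntegral_maxLaw_le [∀ i, NullSingletonClass (D i)] {h : ℝ → ℝ} (hm : Measurable h)
    (h0 : ∀ v, 0 ≤ h v) (h1 : ∀ v, h v ≤ 1) {S : Set ℝ} (hS : MeasurableSet S) :
    ∫ v in S, h v ∂(maxLaw D) ≤
      ∑ i, ∫ v in S, h v * ∏ j, ProbabilityTheory.cdf (D (i.succAbove j)) v ∂(D i) := by
  have hF0 : ∀ i v, 0 ≤ ∏ j, ProbabilityTheory.cdf (D (Fin.succAbove i j)) v := fun i v =>
    Finset.prod_nonneg fun _ _ => ProbabilityTheory.cdf_nonneg _ _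
  have hF1 : ∀ i v, ∏ j, ProbabilityTheory.cdf (D (Fin.succAbove i j)) v ≤ 1 := fun i v =>
    Finset.prod_le_one (fun _ _ => ProbabilityTheory.cdf_nonneg _ _)
      fun _ _ => ProbabilityTheory.cdf_le_one _ _
  have hFm : ∀ i, Measurable fun v => ∏ j, ProbabilityTheory.cdf (D (Fin.succAbove i j)) v :=
    fun i => Finset.measurable_prod _ fun j _ => (continuous_cdf _).measurable
  have hint : ∀ i, Integrable (fun v => h v * ∏ j, ProbabilityTheory.cdf (D (Fin.succAbove i j)) v)
      ((D i).restrict S) := fun i => by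
    refine Integrable.of_bound (hm.mul (hFm i)).aestronglyMeasurable 1
      (Eventually.of_forall fun v => ?_)
    rw [Real.norm_of_nonneg (mul_nonneg (h0 v) (hF0 i v))]
    exact mul_le_one₀ (h1 v) (hF0 i v) (hF1 i v)
  have hint0 : Integrable h ((maxLaw D).restrict S) :=
    Integrable.of_bound hm.aestronglyMeasurable 1 (Eventually.of_forall fun v => by
      rw [Real.norm_of_nonneg (h0 v)]
      exact h1 v)
  rw [← ENNReal.ofReal_le_ofReal_iff (Finset.sum_nonneg fun i _ =>
    integral_nonneg fun v => mul_nonneg (h0 v) (hF0 i v)),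
    ENNReal.ofReal_sum_of_nonneg fun i _ => integral_nonneg fun v => mul_nonneg (h0 v) (hF0 i v),
    ofReal_integral_eq_lintegral_ofReal hint0 (Eventually.of_forall h0)]
  refine (lintegral_mono' (Measure.restrict_mono le_rfl (maxLaw_le_sum_withDensity D))
    le_rfl).trans (le_of_eq ?_)
  rw [← Measure.restrictₗ_apply, map_sum, lintegral_finsetSum_measure]
  refine Finset.sum_congr rfl fun i _ => ?_
  rw [Measure.restrictₗ_apply, ofReal_integral_eq_lintegral_ofReal (hint i)
    (Eventually.of_forall fun v => mul_nonneg (h0 v) (hF0 i v)),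
    setLIntegral_withDensity_eq_setLIntegral_mul _ (hFm i).ennreal_ofReal hm.ennreal_ofReal hS]
  refine lintegral_congr fun v => ?_
  rw [mul_comm (h v), ENNReal.ofReal_mul (hF0 i v)]
  rfl

end MaxLaw

lemma setIntegral_comp_cdf_ge (μ : Measure ℝ) [IsProbabilityMeasure μ] [NullSingletonClass μ]
    {ψ : ℝ → ℝ} (hψ : Measurable ψ) (h0 : ∀ u ∈ Set.Icc (0:ℝ) 1, 0 ≤ ψ u)
    (h1 : ∀ u ∈ Set.Icc (0:ℝ) 1, ψ u ≤ 1) (t : ℝ) :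
    ∫ u in (ProbabilityTheory.cdf μ t)..1, ψ u ≤
      ∫ v in Set.Ici t, ψ (ProbabilityTheory.cdf μ v) ∂μ := by
  set a := ProbabilityTheory.cdf μ t with ha
  have ha' : a ∈ Set.Icc (0:ℝ) 1 := cdf_mem_Icc μ t
  have hm : Measurable ((Set.Ioi a).indicator ψ) := hψ.indicator measurableSet_Ioi
  have hint : Integrable ((Set.Ici t).indicator fun v => ψ (ProbabilityTheory.cdf μ v)) μ :=
    (integrable_comp_cdf μ hψ (C := 1) fun u hu => by
      rw [abs_of_nonneg (h0 u hu)]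
      exact h1 u hu).indicator measurableSet_Ici
  rw [← integral_indicator measurableSet_Ici]
  calc ∫ u in a..1, ψ u
      = ∫ u in (0:ℝ)..1, (Set.Ioi a).indicator ψ u := by
        rw [intervalIntegral.integral_of_le zero_le_one, intervalIntegral.integral_of_le ha'.2,
          setIntegral_indicator measurableSet_Ioi]
        congr 2
        ext u
        simp only [Set.mem_inter_iff, Set.mem_Ioc, Set.mem_Ioi]
        exact ⟨fun h => ⟨⟨ha'.1.trans_lt h.1, h.2⟩, h.1⟩, fun h => ⟨h.2, h.1.2⟩⟩
    _ = ∫ v, (Set.Ioi a).indicator ψ (ProbabilityTheory.cdf μ v) ∂μ := (integral_comp_cdf μ hm).symm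
    _ ≤ ∫ v, (Set.Ici t).indicator (fun v => ψ (ProbabilityTheory.cdf μ v)) v ∂μ := by
        refine integral_mono_of_nonneg (Eventually.of_forall fun v =>
          Set.indicator_apply_nonneg fun _ => h0 _ (cdf_mem_Icc μ v)) hint (Eventually.of_forall fun v => ?_)
        by_cases hv : ProbabilityTheory.cdf μ v ∈ Set.Ioi a
        · have : v ∈ Set.Ici t := by
            by_contra hvt
            exact absurd (ProbabilityTheory.monotone_cdf μ (not_le.1 hvt).le) (not_le.2 hv)
          simp only [Set.indicator_of_mem hv, Set.indicator_of_mem this]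
          exact le_rfl
        · simp only [Set.indicator_of_notMem hv]
          exact Set.indicator_apply_nonneg fun _ => h0 _ (cdf_mem_Icc μ v)

/-! ### Comparison with i.i.d. values through arithmetic and geometric means -/

lemma card_mul_prod_rpow_le_sum {m : ℕ} (hm : 0 < m) (p : Fin m → ℝ) (hp : ∀ k, 0 ≤ p k) :
    m * ∏ k, p k ^ ((m:ℝ)⁻¹) ≤ ∑ k, p k := by
  have hm' : (0:ℝ) < m := Nat.cast_pos.2 hm
  have := Real.geom_mean_le_arith_mean_weighted Finset.univ (fun _ : Fin m => (m:ℝ)⁻¹) p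
    (fun _ _ => by positivity) (by simp [hm'.ne']) fun k _ => hp k
  rw [← Finset.mul_sum] at this
  calc (m:ℝ) * ∏ k, p k ^ ((m:ℝ)⁻¹) ≤ m * ((m:ℝ)⁻¹ * ∑ k, p k) :=
        mul_le_mul_of_nonneg_left this hm'.le
    _ = ∑ k, p k := by field_simp

lemma prod_ite_lt {m : ℕ} (K : Fin m) (f : Fin m → ℝ) (w : ℝ) :
    ∏ k, (if k < K then f k else w) = (∏ k ∈ Finset.Iio K, f k) * w ^ (m - K : ℕ) := by
  rw [Finset.prod_ite, Finset.prod_const]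
  congr 2
  · ext k; simp
  · have : (Finset.univ.filter fun k => ¬ k < K) = Finset.Ici K := by
      ext k; simp
    rw [this, Fin.card_Ici]

/-- The comparison of arithmetic and geometric means behind the reduction to i.i.d. values.
Here `F l k` is the distribution function of item `l` at the bound that is
imposed on the items of block `k`, and `q l` is its value at the maximum. -/
lemma prod_sum_ge {n m : ℕ} (hm : 0 < m) (i : Fin (n + 1)) {F : Fin (n + 1) → Fin m → ℝ}
    {q : Fin (n + 1) → ℝ} {z : Fin m → ℝ} (hF : ∀ l k, 0 ≤ F l k) (hFq : ∀ l k, F l k ≤ q l)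
    (hz : ∀ k, 0 ≤ z k) (hzF : ∀ k, ∏ l, F l k = z k ^ m) :
    m ^ n * ∏ k, z k ≤ (∏ j : Fin n, ∑ k, F (i.succAbove j) k) * q i := by
  have hm' : (0:ℝ) < m := Nat.cast_pos.2 hm
  have hq : 0 ≤ q i := (hF i ⟨0, hm⟩).trans (hFq i ⟨0, hm⟩)
  have h1 : ∏ j : Fin n, ((m:ℝ) * ∏ k, F (i.succAbove j) k ^ ((m:ℝ)⁻¹)) ≤
      ∏ j : Fin n, ∑ k, F (i.succAbove j) k :=
    Finset.prod_le_prod (fun j _ => mul_nonneg hm'.le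
      (Finset.prod_nonneg fun k _ => Real.rpow_nonneg (hF _ _) _))
      fun j _ => card_mul_prod_rpow_le_sum hm _ fun k => hF _ _
  -- `z k` contains a factor from item `i`, which is absent from the product over the other items;
  -- it is replaced by its upper bound `q i`.
  have h2 : ∀ k, z k ≤ (∏ j : Fin n, F (i.succAbove j) k ^ ((m:ℝ)⁻¹)) * q i ^ ((m:ℝ)⁻¹) := by
    intro k
    rw [Real.finsetProd_rpow _ _ fun j _ => hF _ _,
      ← Real.mul_rpow (Finset.prod_nonneg fun j _ => hF _ _) hq]
    calc z k = (z k ^ m) ^ ((m:ℝ)⁻¹) := (Real.pow_rpow_inv_natCast (hz k) hm.ne').symm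
      _ ≤ _ := by
        refine Real.rpow_le_rpow (pow_nonneg (hz k) m) ?_ (by positivity)
        rw [← hzF k, Fin.prod_univ_succAbove _ i, mul_comm]
        exact mul_le_mul_of_nonneg_left (hFq i k) (Finset.prod_nonneg fun j _ => hF _ _)
  have h3 := Finset.prod_le_prod (s := Finset.univ) (fun k _ => hz k) fun k _ => h2 k
  rw [Finset.prod_mul_distrib, Finset.prod_const, Finset.card_univ, Fintype.card_fin,
    Real.rpow_inv_natCast_pow hq hm.ne', Finset.prod_comm] at h3
  rw [Finset.prod_mul_distrib, Finset.prod_const, Finset.card_univ, Fintype.card_fin] at h1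
  calc m ^ n * ∏ k, z k
      ≤ m ^ n * ((∏ j : Fin n, ∏ k, F (i.succAbove j) k ^ ((m:ℝ)⁻¹)) * q i) :=
        mul_le_mul_of_nonneg_left h3 (by positivity)
    _ = (m ^ n * ∏ j : Fin n, ∏ k, F (i.succAbove j) k ^ ((m:ℝ)⁻¹)) * q i := by ring
    _ ≤ _ := mul_le_mul_of_nonneg_right h1 hq

/-- The item `i` is the strict maximum and at least `c`, and every other item of a block before `K`
is below the bound `t` for its block. -/
def slotSet {n m : ℕ} (K : Fin m) (c : ℝ) (t : Fin m → ℝ) (i : Fin n) (b : Fin n → Fin m) :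
    Set (Fin n → ℝ) :=
  {x | x i ∈ Set.Ici c ∧ ∀ l, l ≠ i →
    x l ∈ Set.Iio (if b l < K then min (t (b l)) (x i) else x i)}

lemma measurableSet_slotSet {n m : ℕ} (K : Fin m) (c : ℝ) (t : Fin m → ℝ) (i : Fin n)
    (b : Fin n → Fin m) : MeasurableSet (slotSet K c t i b) := by
  refine measurableSet_setOfPred.2 (Measurable.and ?_ (Measurable.forall fun l =>
    measurable_const.imp ?_))
  · exact measurableSet_setOfPred.1 (measurableSet_le measurable_const (measurable_pi_apply i))
  · refine measurableSet_setOfPred.1 (measurableSet_lt (measurable_pi_apply l) ?_)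
    split_ifs
    · exact measurable_const.min (measurable_pi_apply i)
    · exact measurable_pi_apply i

lemma sum_filter_succAbove {n m : ℕ} (i : Fin (n + 1)) (K : Fin m) (f : (Fin n → Fin m) → ℝ) :
    ∑ b ∈ Finset.univ.filter (fun b : Fin (n + 1) → Fin m => b i = K),
      f (fun j => b (i.succAbove j)) = ∑ c, f c := by
  refine Finset.sum_bij' (fun b _ j => b (i.succAbove j)) (fun c _ => i.insertNth K c)
    (fun _ _ => Finset.mem_univ _) (fun c _ => by simp) (fun b hb => ?_) (fun c _ => by simp)
    fun _ _ => rfl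
  rw [← (Finset.mem_filter.1 hb).2]
  exact Fin.insertNth_self_removeNth i b

/-- The labels of different items vary independently, so the sum over assignments of products over
items is a product over items of sums over blocks. -/
lemma sum_slotSet_eq {n m : ℕ} (D : Fin (n + 1) → Measure ℝ) [∀ i, IsProbabilityMeasure (D i)]
    [∀ i, NullSingletonClass (D i)] (K : Fin m) (c : ℝ) (t : Fin m → ℝ) (i : Fin (n + 1)) :
    ∑ b ∈ Finset.univ.filter (fun b : Fin (n + 1) → Fin m => b i = K),
      (Measure.pi D).real (slotSet K c t i b) =
    ∫ v in Set.Ici c, ∏ j, ∑ k, ProbabilityTheory.cdf (D (i.succAbove j))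
      (if k < K then min (t k) v else v) ∂(D i) := by
  have hy : ∀ k, Continuous fun v : ℝ => if k < K then min (t k) v else v := fun k => by
    split_ifs
    · exact continuous_const.min continuous_id
    · exact continuous_id
  have hslice : ∀ b : Fin (n + 1) → Fin m, (Measure.pi D).real (slotSet K c t i b) =
      ∫ v in Set.Ici c, ∏ j, ProbabilityTheory.cdf (D (i.succAbove j))
        (if b (i.succAbove j) < K then min (t (b (i.succAbove j))) v else v) ∂(D i) := fun b => by
    rw [slotSet, pi_real_slice D i measurableSet_Ici
      (B := fun l v => Set.Iio (if b l < K then min (t (b l)) v else v))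
      fun l => measurableSet_lt measurable_snd ((hy (b l)).measurable.comp measurable_fst)]
    simp only [cdf_eq_real_Iio]
  simp_rw [hslice]
  rw [sum_filter_succAbove i K fun c' => ∫ v in Set.Ici c,
    ∏ j, ProbabilityTheory.cdf (D (i.succAbove j))
      (if c' j < K then min (t (c' j)) v else v) ∂(D i), ← integral_finsetSum]
  · refine integral_congr_ae (Eventually.of_forall fun v => ?_)
    simp only
    rw [Finset.prod_univ_sum, Fintype.piFinset_univ]
  · intro c' _
    refine Integrable.of_bound (Finset.measurable_prod _ fun j _ =>
      ((continuous_cdf _).comp (hy (c' j))).measurable).aestronglyMeasurable 1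
      (Eventually.of_forall fun v => ?_)
    rw [Real.norm_of_nonneg (Finset.prod_nonneg fun _ _ => ProbabilityTheory.cdf_nonneg _ _)]
    exact Finset.prod_le_one (fun _ _ => ProbabilityTheory.cdf_nonneg _ _)
      fun _ _ => ProbabilityTheory.cdf_le_one _ _

/-- Substitute `u = w ^ m`, which turns the distribution function of the maximum into that of a
single one of `m` i.i.d. values. -/
lemma integral_slot_substitution {m : ℕ} (K : Fin m) {a : ℝ} (ha0 : 0 < a) (ha1 : a ≤ 1)
    (g : Fin m → ℝ) :
    ∫ u in (a ^ m)..1, ∏ k ∈ Finset.Iio K, (min (g k) (u ^ ((m:ℝ)⁻¹)) / u ^ ((m:ℝ)⁻¹)) =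
      m * slotValue K a g := by
  have hm : m ≠ 0 := fun h => by subst h; exact K.elim0
  have hsub := intervalIntegral.integral_comp_mul_deriv' (a := a) (b := 1)
    (f := fun w : ℝ => w ^ m) (f' := fun w => (m:ℝ) * w ^ (m - 1))
    (g := fun u : ℝ => ∏ k ∈ Finset.Iio K, (min (g k) (u ^ ((m:ℝ)⁻¹)) / u ^ ((m:ℝ)⁻¹)))
    (fun w _ => hasDerivAt_pow m w) (by fun_prop) (by
      refine continuousOn_finsetProd _ fun k _ => ?_
      have hr : Continuous fun u : ℝ => u ^ ((m:ℝ)⁻¹) :=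
        Real.continuous_rpow_const (by positivity)
      refine (continuous_const.min hr).continuousOn.div hr.continuousOn ?_
      rintro u ⟨w, hw, rfl⟩
      rw [Set.uIcc_of_le ha1] at hw
      exact (Real.rpow_pos_of_pos (pow_pos (ha0.trans_le hw.1) m) _).ne')
  rw [one_pow] at hsub
  rw [← hsub, slotValue, ← intervalIntegral.integral_const_mul]
  refine intervalIntegral.integral_congr fun w hw => ?_
  rw [Set.uIcc_of_le ha1] at hw
  have hw0 : 0 < w := ha0.trans_le hw.1
  simp only [Function.comp_apply, Real.pow_rpow_inv_natCast hw0.le hm, Finset.prod_div_distrib,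
    Finset.prod_const, Fin.card_Iio]
  have hpow : w ^ (m - 1) = w ^ (m - 1 - K : ℕ) * w ^ (K:ℕ) := by
    rw [← pow_add]; congr 1; have := K.2; omega
  rw [hpow]
  field_simp

/-- The total probability of the events `slotSet`, over all items and all assignments of blocks, is
at least its value for i.i.d. blocks. -/
lemma mul_slotValue_le {n m : ℕ} (D : Fin (n + 1) → Measure ℝ) [∀ i, IsProbabilityMeasure (D i)]
    [∀ i, NullSingletonClass (D i)] (K : Fin m) {c a : ℝ} {t g : Fin m → ℝ} (ha0 : 0 < a)
    (ha1 : a ≤ 1) (hg : ∀ k, 0 ≤ g k) (hc : ∏ l, ProbabilityTheory.cdf (D l) c = a ^ m)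
    (ht : ∀ k, ∏ l, ProbabilityTheory.cdf (D l) (t k) = g k ^ m) :
    m ^ (n + 1) * slotValue K a g ≤
      ∑ i, ∑ b ∈ Finset.univ.filter (fun b : Fin (n + 1) → Fin m => b i = K),
        (Measure.pi D).real (slotSet K c t i b) := by
  have hm : 0 < m := K.pos
  set χ : ℝ → ℝ := fun u =>
    ∏ k ∈ Finset.Iio K, (min (g k) (u ^ ((m:ℝ)⁻¹)) / u ^ ((m:ℝ)⁻¹)) with hχ
  have hr0 : ∀ u ∈ Set.Icc (0:ℝ) 1, 0 ≤ u ^ ((m:ℝ)⁻¹) := fun u hu => Real.rpow_nonneg hu.1 _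
  have hχ0 : ∀ u ∈ Set.Icc (0:ℝ) 1, 0 ≤ χ u := fun u hu =>
    Finset.prod_nonneg fun k _ => div_nonneg (le_min (hg k) (hr0 u hu)) (hr0 u hu)
  have hχ1 : ∀ u ∈ Set.Icc (0:ℝ) 1, χ u ≤ 1 := fun u hu =>
    Finset.prod_le_one (fun k _ => div_nonneg (le_min (hg k) (hr0 u hu)) (hr0 u hu))
      fun k _ => div_le_one_of_le₀ (min_le_right _ _) (hr0 u hu)
  have hχm : Measurable χ := Finset.measurable_prod _ fun k _ =>
    (measurable_const.min (measurable_id.pow_const _)).div (measurable_id.pow_const _)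
  set M := maxLaw D with hM
  have hMc : ∀ v, ProbabilityTheory.cdf M v = ∏ l, ProbabilityTheory.cdf (D l) v := cdf_maxLaw D
  have hFm : Measurable (ProbabilityTheory.cdf M) := (continuous_cdf M).measurable
  have h1 : m * slotValue K a g ≤ ∫ v in Set.Ici c, χ (ProbabilityTheory.cdf M v) ∂M := by
    rw [← integral_slot_substitution K ha0 ha1 g, ← hc, ← hMc]
    exact setIntegral_comp_cdf_ge M hχm hχ0 hχ1 c
  have h2 := setIntegral_maxLaw_le D (h := fun v => χ (ProbabilityTheory.cdf M v)) (hχm.comp hFm)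
    (fun v => hχ0 _ (cdf_mem_Icc M v)) (fun v => hχ1 _ (cdf_mem_Icc M v))
    (measurableSet_Ici (a := c))
  have hy : ∀ k, Continuous fun v : ℝ => if k < K then min (t k) v else v := fun k => by
    split_ifs
    · exact continuous_const.min continuous_id
    · exact continuous_id
  have h3 : ∀ i, m ^ n * ∫ v in Set.Ici c, χ (ProbabilityTheory.cdf M v) *
        ∏ j, ProbabilityTheory.cdf (D (i.succAbove j)) v ∂(D i) ≤
      ∑ b ∈ Finset.univ.filter (fun b : Fin (n + 1) → Fin m => b i = K),
        (Measure.pi D).real (slotSet K c t i b) := fun i => by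
    rw [sum_slotSet_eq, ← integral_const_mul]
    refine integral_mono_of_nonneg (Eventually.of_forall fun v => mul_nonneg (by positivity)
      (mul_nonneg (hχ0 _ (cdf_mem_Icc M v)) (Finset.prod_nonneg fun _ _ =>
        ProbabilityTheory.cdf_nonneg _ _))) ?_ ?_
    · refine Integrable.of_bound (C := (m:ℝ) ^ n) (Finset.measurable_prod _ fun j _ =>
        Finset.measurable_sum _ fun k _ =>
          ((continuous_cdf _).comp (hy k)).measurable).aestronglyMeasurable
        (Eventually.of_forall fun v => ?_)
      have hnn : ∀ j : Fin n, 0 ≤ ∑ k, ProbabilityTheory.cdf (D (i.succAbove j))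
          (if k < K then min (t k) v else v) := fun j =>
        Finset.sum_nonneg fun _ _ => ProbabilityTheory.cdf_nonneg _ _
      rw [Real.norm_of_nonneg (Finset.prod_nonneg fun j _ => hnn j)]
      refine (Finset.prod_le_prod (fun j _ => hnn j) fun j _ =>
        Finset.sum_le_sum fun k _ => ProbabilityTheory.cdf_le_one _ _).trans (le_of_eq ?_)
      simp
    · refine (ae_restrict_iff' measurableSet_Ici).2 (Eventually.of_forall fun v hv => ?_)
      set w := ProbabilityTheory.cdf M v ^ ((m:ℝ)⁻¹) with hw
      have hFpos : 0 < ProbabilityTheory.cdf M v := by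
        refine lt_of_lt_of_le ?_ (ProbabilityTheory.monotone_cdf M hv)
        rw [hMc, hc]
        exact pow_pos ha0 m
      have hw0 : 0 < w := Real.rpow_pos_of_pos hFpos _
      have hwm : w ^ m = ProbabilityTheory.cdf M v := Real.rpow_inv_natCast_pow hFpos.le hm.ne'
      -- The bound for block `k` is a quantile of the maximum capped at `v` for blocks before `K`,
      -- and `v` itself for the rest. Its level under the law of the maximum is the `m`-th power of
      -- the i.i.d. level.
      have hkey := prod_sum_ge hm i (F := fun l k => ProbabilityTheory.cdf (D l)
        (if k < K then min (t k) v else v)) (q := fun l => ProbabilityTheory.cdf (D l) v)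
        (z := fun k => if k < K then min (g k) w else w)
        (fun _ _ => ProbabilityTheory.cdf_nonneg _ _)
        (fun l k => ProbabilityTheory.monotone_cdf _ (by
          split_ifs
          · exact min_le_right _ _
          · exact le_rfl))
        (fun k => by
          split_ifs
          · exact le_min (hg k) hw0.le
          · exact hw0.le)
        (fun k => by
          rw [← hMc]
          split_ifs
          · rw [(ProbabilityTheory.monotone_cdf M).map_min, hMc (t k), ht, ← hwm]
            rcases le_total (g k) w with h | h
            · rw [min_eq_left h, min_eq_left (pow_le_pow_left₀ (hg k) h m)]
            · rw [min_eq_right h, min_eq_right (pow_le_pow_left₀ hw0.le h m)]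
          · exact hwm.symm)
      rw [prod_ite_lt] at hkey
      -- Positivity permits cancelling the factor of item `i`, which completes the product over the
      -- other items to the distribution function of the maximum.
      have hqpos : 0 < ProbabilityTheory.cdf (D i) v := by
        refine lt_of_le_of_ne (ProbabilityTheory.cdf_nonneg _ _) fun h => hFpos.ne' ?_
        rw [hMc]
        exact Finset.prod_eq_zero (Finset.mem_univ i) h.symm
      refine le_of_mul_le_mul_right (le_trans (le_of_eq ?_) hkey) hqpos
      have hprod : (∏ j, ProbabilityTheory.cdf (D (i.succAbove j)) v) *
          ProbabilityTheory.cdf (D i) v = w ^ m := by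
        rw [hwm, hMc, Fin.prod_univ_succAbove _ i, mul_comm]
      have hpow : w ^ m = w ^ (m - K : ℕ) * w ^ (K:ℕ) := by
        rw [← pow_add]; congr 1; have := K.2; omega
      simp only [hχ, ← hw]
      rw [mul_assoc, mul_assoc (∏ k ∈ Finset.Iio K, (min (g k) w / w)), hprod, hpow,
        Finset.prod_div_distrib, Finset.prod_const, Fin.card_Iio]
      field_simp
  calc (m:ℝ) ^ (n + 1) * slotValue K a g = m ^ n * (m * slotValue K a g) := by ring
    _ ≤ m ^ n * ∑ i, ∫ v in Set.Ici c, χ (ProbabilityTheory.cdf M v) *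
        ∏ j, ProbabilityTheory.cdf (D (i.succAbove j)) v ∂(D i) :=
      mul_le_mul_of_nonneg_left (h1.trans h2) (by positivity)
    _ ≤ _ := by
      rw [Finset.mul_sum]
      exact Finset.sum_le_sum fun i _ => h3 i

/-! ### Counting assignments of blocks -/

/-- The number of pairs of an item and an assignment of blocks for which `slotSet` occurs. -/
noncomputable def slotCount {n m : ℕ} (K : Fin m) (c : ℝ) (t : Fin m → ℝ) (x : Fin n → ℝ) : ℝ :=
  ∑ i, ∑ b ∈ Finset.univ.filter (fun b : Fin n → Fin m => b i = K),
    (slotSet K c t i b).indicator 1 x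

section Integral

variable {n m : ℕ} (D : Fin n → Measure ℝ) [∀ i, IsProbabilityMeasure (D i)]

lemma integrable_indicator_one_pi {S : Set (Fin n → ℝ)} (hS : MeasurableSet S) :
    Integrable (S.indicator (1 : (Fin n → ℝ) → ℝ)) (Measure.pi D) :=
  (integrable_const (1:ℝ)).indicator hS

lemma integrable_slotCount (K : Fin m) (c : ℝ) (t : Fin m → ℝ) :
    Integrable (slotCount K c t) (Measure.pi D) :=
  integrable_finsetSum _ fun i _ => integrable_finsetSum _ fun b _ =>
    integrable_indicator_one_pi D (measurableSet_slotSet K c t i b)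

lemma integral_slotCount (K : Fin m) (c : ℝ) (t : Fin m → ℝ) :
    ∫ x, slotCount K c t x ∂(Measure.pi D) =
      ∑ i, ∑ b ∈ Finset.univ.filter (fun b : Fin n → Fin m => b i = K),
        (Measure.pi D).real (slotSet K c t i b) := by
  unfold slotCount
  rw [integral_finsetSum _ fun i _ => integrable_finsetSum _ fun b _ =>
    integrable_indicator_one_pi D (measurableSet_slotSet K c t i b)]
  refine Finset.sum_congr rfl fun i _ => ?_
  rw [integral_finsetSum _ fun b _ =>
    integrable_indicator_one_pi D (measurableSet_slotSet K c t i b)]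
  exact Finset.sum_congr rfl fun b _ => integral_indicator_one (measurableSet_slotSet K c t i b)

end Integral

/-- Only the item of maximal value can contribute, because `slotSet` requires its item to exceed all
others strictly. -/
lemma slotCount_le {n m : ℕ} (K : Fin m) (c : ℝ) (t : Fin m → ℝ) {x : Fin n → ℝ} {i : Fin n}
    (hi : ∀ j, x j ≤ x i) : slotCount K c t x ≤
      (Nat.card {b : Fin n → Fin m // b i = K ∧ c ≤ x i ∧ ∀ l, b l < K → x l < t (b l)} : ℝ) := by
  classical
  have hother : ∀ j, j ≠ i → ∑ b ∈ Finset.univ.filter (fun b : Fin n → Fin m => b j = K),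
      (slotSet K c t j b).indicator (1 : (Fin n → ℝ) → ℝ) x = 0 := fun j hj =>
    Finset.sum_eq_zero fun b _ => Set.indicator_of_notMem (fun hx => by
      have h : x i < if b i < K then min (t (b i)) (x j) else x j := hx.2 i hj.symm
      have h' : (if b i < K then min (t (b i)) (x j) else x j) ≤ x j := by
        split_ifs
        · exact min_le_right _ _
        · exact le_rfl
      exact absurd (hi j) (not_le.2 (h.trans_le h'))) _
  rw [slotCount, Finset.sum_eq_single i (fun j _ hj => hother j hj) (by simp)]
  rw [Nat.card_eq_fintype_card, Fintype.card_subtype, ← Finset.filter_filter,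
    Finset.card_filter, Nat.cast_sum]
  refine Finset.sum_le_sum fun b hb => ?_
  have hbi : b i = K := (Finset.mem_filter.1 hb).2
  by_cases hx : x ∈ slotSet K c t i b
  · have hlt : ∀ l, b l < K → x l < t (b l) := fun l hl => by
      have hli : l ≠ i := fun h => by
        rw [h, hbi] at hl
        exact lt_irrefl _ hl
      have h : x l < if b l < K then min (t (b l)) (x i) else x i := hx.2 l hli
      rw [if_pos hl] at h
      exact h.trans_le (min_le_left _ _)
    rw [Set.indicator_of_mem hx, if_pos ⟨hx.1, hlt⟩, Pi.one_apply, Nat.cast_one]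
  · rw [Set.indicator_of_notMem hx]
    positivity

/-- The counterpart of `ThresholdRule.value` for the assignments of blocks to the items `x`. -/
noncomputable def ThresholdRule.blockCount (r : ThresholdRule) {n m : ℕ} (τ : Fin m → ℝ)
    (x : Fin n → ℝ) : ℝ :=
  match r with
  | .plain => ∑ K, slotCount K (τ K) τ x
  | .record => ∑ K : Fin m, if (K:ℕ) = 0 then slotCount K (τ K) τ x else
      (∑ J ∈ Finset.Iio K, slotCount K (τ K) (fun _ => τ J) x) / (K:ℕ)

/-- The assignments are sorted by the block `K` of the maximal item. For the record rule and `K >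
0`, the average over `J` is bounded by relabelling the largest earlier item; for `K = 0` nothing
precedes. -/
lemma blockCount_le_card_blockReaches (r : ThresholdRule) {n m : ℕ} {τ : Fin m → ℝ}
    (hτ : r = .record → Antitone τ) {x : Fin n → ℝ} (hx : Function.Injective x) {i : Fin n}
    (hi : ∀ j, x j ≤ x i) :
    r.blockCount τ x ≤ (Nat.card {b // r.BlockReaches τ b x i} : ℝ) := by
  classical
  have hfib : Nat.card {b // r.BlockReaches τ b x i} =
      ∑ K : Fin m, Nat.card {b // b i = K ∧ r.BlockReaches τ b x i} := by
    simp only [Nat.card_eq_fintype_card, Fintype.card_subtype]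
    rw [Finset.card_eq_sum_card_fiberwise (f := fun b : Fin n → Fin m => b i)
      (t := Finset.univ) fun _ _ => by simp]
    refine Finset.sum_congr rfl fun K _ => ?_
    rw [Finset.filter_filter]
    congr 1
    ext b
    simp [and_comm]
  rw [hfib, Nat.cast_sum]
  have hmono : ∀ {P Q : (Fin n → Fin m) → Prop}, (∀ b, P b → Q b) →
      (Nat.card {b // P b} : ℝ) ≤ Nat.card {b // Q b} := fun h =>
    Nat.cast_le.2 (Nat.card_le_card_of_injective (Subtype.map id h)
      (Subtype.map_injective h Function.injective_id))
  cases r with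
  | plain =>
    refine Finset.sum_le_sum fun K _ => (slotCount_le K (τ K) τ hi).trans (hmono fun b hb => ?_)
    obtain ⟨hbi, hc, hlow⟩ := hb
    exact ⟨hbi, hbi ▸ hc, fun l hl => not_le.2 (hlow l (hbi ▸ hl))⟩
  | record =>
    refine Finset.sum_le_sum fun K _ => ?_
    split_ifs with hK
    · refine (slotCount_le K (τ K) τ hi).trans (hmono fun b hb => ?_)
      obtain ⟨hbi, hc, -⟩ := hb
      refine ⟨hbi, hbi ▸ hc, fun l hl => ?_⟩
      rw [hbi, Fin.lt_def, hK] at hl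
      exact absurd hl (Nat.not_lt_zero _)
    · have hKpos : (0:ℝ) < (K:ℕ) := by exact_mod_cast Nat.pos_of_ne_zero hK
      rw [div_le_iff₀ hKpos]
      by_cases hc : τ K ≤ x i
      · have := sum_card_le_mul_card_blockReaches (hτ rfl) hx i K hc
        calc _ ≤ ∑ J ∈ Finset.Iio K, (Nat.card {b : Fin n → Fin m //
              b i = K ∧ ∀ l, b l < K → x l < τ J} : ℝ) :=
              Finset.sum_le_sum fun J _ => (slotCount_le K (τ K) _ hi).trans
                (hmono fun b hb => ⟨hb.1, hb.2.2⟩)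
          _ ≤ _ := by
              rw [mul_comm]
              exact_mod_cast this
      · have hzero : ∀ J ∈ Finset.Iio K, slotCount K (τ K) (fun _ => τ J) x ≤ 0 := fun J _ => by
          refine (slotCount_le K (τ K) _ hi).trans (le_of_eq ?_)
          have : IsEmpty {b : Fin n → Fin m // b i = K ∧ τ K ≤ x i ∧
              ∀ l, b l < K → x l < τ J} := ⟨fun b => hc b.2.2.1⟩
          simp
        exact (Finset.sum_nonpos hzero).trans (by positivity)

section Comparison

variable {n : ℕ} (D : Fin (n + 1) → Measure ℝ) [∀ i, IsProbabilityMeasure (D i)]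
  [∀ i, NullSingletonClass (D i)]

lemma integral_blockCount_le (r : ThresholdRule) {m : ℕ} {τ : Fin m → ℝ}
    (hτ : r = .record → Antitone τ) :
    ∫ x, r.blockCount τ x ∂(Measure.pi D) ≤
      (∑ b : Fin (n + 1) → Fin m, (Measure.pi D).real {x | r.BlockSelects τ b x}) + m ^ n := by
  classical
  have hcount : ∀ x, (Nat.card {b // r.BlockSelects τ b x} : ℝ) =
      ∑ b : Fin (n + 1) → Fin m, {x | r.BlockSelects τ b x}.indicator 1 x := fun x => by
    rw [Nat.card_eq_fintype_card, Fintype.card_subtype, Finset.card_filter, Nat.cast_sum]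
    refine Finset.sum_congr rfl fun b _ => ?_
    by_cases h : r.BlockSelects τ b x
    · rw [if_pos h, Set.indicator_of_mem (by exact h)]
      simp
    · rw [if_neg h, Set.indicator_of_notMem (by exact h)]
      simp
  have hint : ∀ b ∈ (Finset.univ : Finset (Fin (n + 1) → Fin m)),
      Integrable ({x | r.BlockSelects τ b x}.indicator (1 : (Fin (n + 1) → ℝ) → ℝ))
        (Measure.pi D) :=
    fun b _ => integrable_indicator_one_pi D (measurableSet_blockSelects r τ b)
  have hint' : Integrable (r.blockCount τ) (Measure.pi D) := by
    cases r with
    | plain => exact integrable_finsetSum _ fun K _ => integrable_slotCount D K _ _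
    | record =>
      refine integrable_finsetSum _ fun K _ => ?_
      split_ifs
      · exact integrable_slotCount D K _ _
      · exact (integrable_finsetSum _ fun J _ => integrable_slotCount D K _ _).div_const _
  have hle : ∀ᵐ x ∂(Measure.pi D), r.blockCount τ x ≤
      (∑ b : Fin (n + 1) → Fin m, {x | r.BlockSelects τ b x}.indicator 1 x) + (m:ℝ) ^ n := by
    filter_upwards [ae_injective_pi D] with x hx
    obtain ⟨i, -, hi⟩ := Finset.univ.exists_max_image x Finset.univ_nonempty
    have hi : ∀ j, x j ≤ x i := fun j => hi j (Finset.mem_univ j)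
    rw [← hcount]
    refine (blockCount_le_card_blockReaches r hτ hx hi).trans ?_
    exact_mod_cast card_blockReaches_le r τ hi
  refine (integral_mono_ae hint' ((integrable_finsetSum _ hint).add (integrable_const _))
    hle).trans (le_of_eq ?_)
  rw [integral_add' (integrable_finsetSum _ hint) (integrable_const _), integral_finsetSum _ hint]
  congr 1
  · exact Finset.sum_congr rfl fun b _ =>
      integral_indicator_one (measurableSet_blockSelects r τ b)
  · simp

lemma mul_value_le_integral_blockCount (r : ThresholdRule) {m : ℕ} {s τ : Fin m → ℝ}
    (hs : ∀ k, s k ∈ Set.Ioo (0:ℝ) 1)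
    (hτ : ∀ k, ∏ l, ProbabilityTheory.cdf (D l) (τ k) = s k ^ m) :
    m ^ (n + 1) * r.value s ≤ ∫ x, r.blockCount τ x ∂(Measure.pi D) := by
  have hslot : ∀ K : Fin m, m ^ (n + 1) * slotValue K (s K) s ≤
      ∫ x, slotCount K (τ K) τ x ∂(Measure.pi D) := fun K => by
    rw [integral_slotCount]
    exact mul_slotValue_le D K (hs K).1 (hs K).2.le (fun k => (hs k).1.le) (hτ K) hτ
  have hslot' : ∀ K J : Fin m, m ^ (n + 1) * slotValue K (s K) (fun _ => s J) ≤
      ∫ x, slotCount K (τ K) (fun _ => τ J) x ∂(Measure.pi D) := fun K J => by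
    rw [integral_slotCount]
    exact mul_slotValue_le D K (hs K).1 (hs K).2.le (fun _ => (hs J).1.le) (hτ K) fun _ => hτ J
  cases r with
  | plain =>
    simp only [ThresholdRule.value, ThresholdRule.blockCount]
    rw [integral_finsetSum _ fun K _ => integrable_slotCount D K _ _, Finset.mul_sum]
    exact Finset.sum_le_sum fun K _ => hslot K
  | record =>
    simp only [ThresholdRule.value, ThresholdRule.blockCount]
    rw [integral_finsetSum, Finset.mul_sum]
    · refine Finset.sum_le_sum fun K _ => ?_
      by_cases hK : (K:ℕ) = 0
      · simp only [if_pos hK]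
        refine le_trans (le_of_eq ?_) (hslot K)
        have : Finset.Iio K = ∅ := by
          ext j
          simp [Fin.lt_def, hK]
        simp [slotValue, this]
      · simp only [if_neg hK]
        rw [integral_div, integral_finsetSum _ fun J _ => integrable_slotCount D K _ _,
          ← mul_div_assoc, Finset.mul_sum]
        gcongr with J
        exact hslot' K J
    · intro K _
      split_ifs
      · exact integrable_slotCount D K _ _
      · exact (integrable_finsetSum _ fun J _ => integrable_slotCount D K _ _).div_const _

/-- Any thresholds for `m` i.i.d. values yield thresholds for independent values in random order
that lose at most `1 / m` and an arbitrarily small `δ`. No bound on the probability that a given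
distribution attains the maximum is needed. -/
lemma exists_secretarySuccess_ge_value (r : ThresholdRule) {m : ℕ} (hm : 0 < m) {s : Fin m → ℝ}
    (hs : ∀ k, s k ∈ Set.Icc (0:ℝ) 1) (hanti : r = .record → Antitone s) {δ : ℝ} (hδ : 0 < δ) :
    ∃ τ : Fin (n + 1) → ℝ, r.value s - 1 / m - δ ≤ secretarySuccess r D τ := by
  obtain ⟨s', hs', hanti', hval⟩ := r.exists_interior_value hs hδ
  have hm' : (0:ℝ) < m := Nat.cast_pos.2 hm
  have hex : ∀ y : ℝ, ∃ x, y ∈ Set.Ioo (0:ℝ) 1 → ProbabilityTheory.cdf (maxLaw D) x = y :=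
    fun y => by
      by_cases hy : y ∈ Set.Ioo (0:ℝ) 1
      · obtain ⟨x, hx⟩ := exists_cdf_eq (maxLaw D) hy.1 hy.2
        exact ⟨x, fun _ => hx⟩
      · exact ⟨0, fun h => absurd h hy⟩
  choose q hq using hex
  have hmem : ∀ k, s' k ^ m ∈ Set.Ioo (0:ℝ) 1 := fun k =>
    ⟨pow_pos (hs' k).1 m, pow_lt_one₀ (hs' k).1.le (hs' k).2 hm.ne'⟩
  -- Thresholds are quantiles of the maximum at level `s' k ^ m`, which exist because `s'` lies
  -- strictly inside the unit interval.
  set τ : Fin m → ℝ := fun k => q (s' k ^ m)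
  have hτ : ∀ k, ∏ l, ProbabilityTheory.cdf (D l) (τ k) = s' k ^ m := fun k => by
    rw [← cdf_maxLaw]
    exact hq _ (hmem k)
  have hτanti : r = .record → Antitone τ := fun hr i j hij => by
    rcases (pow_le_pow_left₀ (hs' j).1.le (hanti' (hanti hr) hij) m).eq_or_lt with h | h
    -- Quantiles need not be unique, but equal levels are given the same one, so equal levels keep
    -- `τ` antitone.
    · exact (congrArg q h).le
    · by_contra! hlt
      have := ProbabilityTheory.monotone_cdf (maxLaw D) hlt.le
      rw [hq _ (hmem i), hq _ (hmem j)] at this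
      exact absurd this (not_le.2 h)
  obtain ⟨τ', hτ'⟩ := exists_secretarySuccess_ge r hm D τ
  refine ⟨τ', le_trans ?_ hτ'⟩
  have h := (mul_value_le_integral_blockCount D r hs' hτ).trans (integral_blockCount_le D r hτanti)
  rw [le_div_iff₀ (by positivity)]
  have h2 : (1:ℝ) / m * m ^ (n + 1) = m ^ n := by
    rw [pow_succ]; field_simp
  have h3 := mul_le_mul_of_nonneg_right hval (pow_nonneg hm'.le (n + 1))
  rw [sub_mul] at h3
  rw [sub_mul, sub_mul, h2]
  linarith

end Comparison

/-! ### Transfer of thresholds and the limit constant -/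

/-- Plain thresholds are carried over by the distribution function. Record thresholds are discarded
in favour of the optimal antitone ones, since the formula for the record value relies on
monotonicity. -/
lemma exists_value_ge_iidSuccess (r : ThresholdRule) {m : ℕ} (μ : Measure ℝ)
    [IsProbabilityMeasure μ] [NullSingletonClass μ] (σ : Fin m → ℝ) :
    ∃ s : Fin m → ℝ, (∀ k, s k ∈ Set.Icc (0:ℝ) 1) ∧ (r = .record → Antitone s) ∧
      iidSuccess r μ σ ≤ r.value s := by
  cases r with
  | plain => exact ⟨_, fun k => cdf_mem_Icc μ (σ k), by simp, iidSuccess_plain_le μ σ⟩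
  | record =>
    obtain ⟨s, hs, hs01, hV⟩ := exists_antitone_optV_eq m
    refine ⟨fun k => s k, fun k => hs01 k, fun _ i j hij => hs hij, ?_⟩
    rw [← recordValue_eq_value, ← hV]
    exact iidSuccess_record_le μ σ

lemma exists_secretarySuccess_ge_optV {n : ℕ} (hn : 0 < n) (D : Fin n → Measure ℝ)
    [∀ i, IsProbabilityMeasure (D i)] [∀ i, NullSingletonClass (D i)] {m : ℕ} (hm : 0 < m) {δ : ℝ}
    (hδ : 0 < δ) :
    ∃ τ : Fin n → ℝ, optV m 0 - 1 / m - δ ≤ secretarySuccess ThresholdRule.record D τ := by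
  obtain ⟨n, rfl⟩ : ∃ n', n = n' + 1 := ⟨n - 1, by omega⟩
  obtain ⟨s, hs, hs01, hV⟩ := exists_antitone_optV_eq m
  rw [hV, recordValue_eq_value]
  exact exists_secretarySuccess_ge_value D .record hm (fun k => hs01 k) (fun _ i j hij => hs hij) hδ

lemma secretarySuccess_const (r : ThresholdRule) {n : ℕ} (μ : Measure ℝ) [IsProbabilityMeasure μ]
    (τ : Fin n → ℝ) : secretarySuccess r (fun _ => μ) τ = iidSuccess r μ τ := by
  have h : ∀ π : Equiv.Perm (Fin n), (Measure.pi fun _ : Fin n => μ).real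
      {x | r.SelectsMax τ fun k => x (π k)} = iidSuccess r μ τ := fun π => by
    have hmp := measurePreserving_piCongrLeft (fun _ : Fin n => μ) π.symm
    have := hmp.measure_preimage_equiv {x | r.SelectsMax τ x}
    rw [iidSuccess, measureReal_def, measureReal_def, ← this]
    congr 2
    ext x
    have : (MeasurableEquiv.piCongrLeft (fun _ : Fin n => ℝ) π.symm) x = fun k => x (π k) := by
      funext k
      have := Equiv.piCongrLeft_apply_apply (P := fun _ : Fin n => ℝ) π.symm x (π k)
      rwa [Equiv.symm_apply_apply] at this
    simp [this]
  rw [secretarySuccess, Finset.sum_congr rfl fun π _ => h π]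
  have : (n.factorial : ℝ) ≠ 0 := by positivity
  simp [Fintype.card_perm, this]

lemma iidOptimum_le (μ : Measure ℝ) [IsProbabilityMeasure μ] [NullSingletonClass μ] (m : ℕ) :
    iidOptimum μ m ≤ optV m 0 :=
  ciSup_le fun σ => iidSuccess_record_le μ σ

/-- The comparison theorem applied to `m` items with a common distribution, treated as `k` blocks; a
random order has no effect on i.i.d. items. -/
lemma optV_sub_le_iidOptimum (μ : Measure ℝ) [IsProbabilityMeasure μ] [NullSingletonClass μ]
    {k m : ℕ} (hk : 0 < k) (hm : 0 < m) : optV k 0 - 1 / k ≤ iidOptimum μ m := by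
  refine le_of_forall_pos_sub_le fun δ hδ => ?_
  obtain ⟨τ, hτ⟩ := exists_secretarySuccess_ge_optV hm (fun _ => μ) hk hδ
  rw [secretarySuccess_const] at hτ
  refine hτ.trans (le_ciSup (f := fun σ : Fin m → ℝ => iidSuccess ThresholdRule.record μ σ)
    ⟨optV m 0, ?_⟩ τ)
  rintro _ ⟨σ, rfl⟩
  exact iidSuccess_record_le μ σ

lemma optV_sub_le_optV {k m : ℕ} (hk : 0 < k) (hm : 0 < m) : optV k 0 - 1 / k ≤ optV m 0 := by
  have : IsProbabilityMeasure (volume.restrict (Set.Icc (0:ℝ) 1)) := ⟨by simp⟩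
  exact (optV_sub_le_iidOptimum (volume.restrict (Set.Icc (0:ℝ) 1)) hk hm).trans
    (iidOptimum_le _ m)

/-- The limit of the optimal success probabilities (the Gilbert–Mosteller constant). -/
lemma exists_optV_limit : ∃ α : ℝ, ∀ m : ℕ, 0 < m → optV m 0 - 1 / m ≤ α ∧ α ≤ optV m 0 := by
  refine ⟨⨆ k : ℕ, optV (k + 1) 0 - 1 / (k + 1 : ℕ), fun m hm => ⟨?_, ?_⟩⟩
  · obtain ⟨k, rfl⟩ : ∃ k, m = k + 1 := ⟨m - 1, by omega⟩
    refine le_ciSup (f := fun k : ℕ => optV (k + 1) 0 - 1 / (k + 1 : ℕ)) ⟨optV 1 0, ?_⟩ k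
    rintro _ ⟨k, rfl⟩
    exact optV_sub_le_optV k.succ_pos one_pos
  · exact ciSup_le fun k => optV_sub_le_optV k.succ_pos hm

lemma one_div_iidCount_le {γ : ℝ} (h0 : 0 < γ) (h1 : γ < 1) :
    0 < iidCount γ ∧ (1:ℝ) / iidCount γ ≤ γ := by
  have hpos : 0 < 2 / γ ^ 2 := by positivity
  have hle : 2 / γ ^ 2 ≤ (iidCount γ : ℝ) := Nat.le_ceil _
  refine ⟨Nat.ceil_pos.2 hpos, ?_⟩
  calc (1:ℝ) / iidCount γ ≤ 1 / (2 / γ ^ 2) := one_div_le_one_div_of_le hpos hle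
    _ = γ ^ 2 / 2 := by field_simp
    _ ≤ γ := by nlinarith

theorem mainTheorem7 :
    (∀ (r : ThresholdRule) (γ : ℝ), 0 < γ → γ < 1 →
      ∀ (α : ℝ) (μ : Measure ℝ) [IsProbabilityMeasure μ] [NullSingletonClass μ]
        (σ : Fin (iidCount γ) → ℝ), α ≤ iidSuccess r μ σ →
      ∀ (n : ℕ), 0 < n →
      ∀ (D : Fin n → Measure ℝ) [∀ i, IsProbabilityMeasure (D i)] [∀ i, NullSingletonClass (D i)],
        NoSuperstars (superstarBound γ) D →
        ∃ τ : Fin n → ℝ, α - 13 * γ ≤ secretarySuccess r D τ) ∧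
    (∃ αGM : ℝ, (0.5801 : ℝ) ≤ αGM ∧
      (∀ (μ : Measure ℝ) [IsProbabilityMeasure μ] [NullSingletonClass μ],
        Tendsto (fun m : ℕ => iidOptimum μ m) atTop (𝓝 αGM)) ∧
      ∀ (γ : ℝ), 0 < γ → γ < 1 →
      ∀ (n : ℕ), 0 < n →
      ∀ (D : Fin n → Measure ℝ) [∀ i, IsProbabilityMeasure (D i)] [∀ i, NullSingletonClass (D i)],
        NoSuperstars (superstarBound γ) D →
        ∃ τ : Fin n → ℝ, αGM - 13 * γ ≤ secretarySuccess ThresholdRule.record D τ) := by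
  constructor
  · intro r γ h0 h1 α μ _ _ σ hα n hn D _ _ _
    obtain ⟨n, rfl⟩ : ∃ n', n = n' + 1 := ⟨n - 1, by omega⟩
    obtain ⟨s, hs, hanti, hval⟩ := exists_value_ge_iidSuccess r μ σ
    obtain ⟨hm, hle⟩ := one_div_iidCount_le h0 h1
    -- With `δ = γ` and `1 / m ≤ γ`, the total loss is at most `2 * γ`.
    obtain ⟨τ, hτ⟩ := exists_secretarySuccess_ge_value D r hm hs hanti h0
    exact ⟨τ, by linarith⟩
  · obtain ⟨α, hα⟩ := exists_optV_limit
    have hinv : Tendsto (fun m : ℕ => (1:ℝ) / m) atTop (𝓝 0) := tendsto_one_div_atTop_nhds_zero_nat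
    have hV : Tendsto (fun m : ℕ => optV m 0) atTop (𝓝 α) := by
      have hup : Tendsto (fun m : ℕ => α + 1 / (m:ℝ)) atTop (𝓝 α) := by
        simpa using hinv.const_add α
      refine tendsto_of_tendsto_of_tendsto_of_le_of_le' tendsto_const_nhds hup ?_ ?_
      · filter_upwards [eventually_gt_atTop 0] with m hm using (hα m hm).2
      · filter_upwards [eventually_gt_atTop 0] with m hm
        linarith [(hα m hm).1]
    refine ⟨α, le_of_tendsto_optV hV, fun μ _ _ => ?_, fun γ h0 h1 n hn D _ _ _ => ?_⟩
    · have hlow : Tendsto (fun m : ℕ => optV m 0 - 1 / (m:ℝ)) atTop (𝓝 α) := by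
        simpa using hV.sub hinv
      refine tendsto_of_tendsto_of_tendsto_of_le_of_le' hlow hV ?_
        (Eventually.of_forall fun m => iidOptimum_le μ m)
      filter_upwards [eventually_gt_atTop 0] with m hm using optV_sub_le_iidOptimum μ hm hm
    · obtain ⟨hm, hle⟩ := one_div_iidCount_le h0 h1
      obtain ⟨τ, hτ⟩ := exists_secretarySuccess_ge_optV hn D hm h0
      exact ⟨τ, by linarith [(hα _ hm).2]⟩
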